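/- Let $l\ge 1$ be an integer. Let $B_{X1},B_{X2},\dots$ and $B_{Y1},B_{Y2},\dots$ be two i.i.d. sequences, each variable being uniformly distributed on $\{l-1,l,l+1\}$, and let $c_X,c_Y$ be uniformly distributed on $\{0,1\}$, all these random variables being independent. Let $X^\infty$ be the infinite binary sequence obtained by concatenating blocks of lengths $B_{X1},B_{X2},\dots$, the letter being $c_X$ in the odd-numbered blocks and $1-c_X$ in the even-numbered blocks, and define $Y^\infty$ in the same way from $c_Y$ and $(B_{Yi})_i$. (If $l=1$, some of the concatenated blocks may be empty.) For $n\ge 1$ let $X=X_1\cdots X_n$ and $Y=Y_1\cdots Y_n$ consist of the first $n$ letters of $X^\infty$ and $Y^\infty$. The blocks of a finite word are its maximal runs of equal letters. An alignment of $X$ and $Y$ is a finite set of pairs $(i,j)\in\{1,\dots,n\}^2$ with $X_i=Y_j$ that is strictly increasing in both coordinates; it is optimal if it has the largest possible number of pairs, namely the length of a longest common subsequence of $X$ and $Y$. A block of $X$ (of $Y$) is left out by an alignment if none of its positions occurs in a pair of the alignment; it is left out at the end if it and all blocks to its right are left out. For $\delta>0$ let $J^n(\delta)$ be the event that, in every optimal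 alignment of $X$ and $Y$, the number of blocks of $X$ left out at the end is at most $\delta$ times the total number of blocks of $X$, and the number of blocks of $Y$ left out at the end is at most $\delta$ times the total number of blocks of $Y$. **Proposition.** For every $\delta>0$ there is a constant $\theta>0$, depending only on $l$ and $\delta$ and not on $n$, such that for all sufficiently large $n$ \[ \mathrm{P}\bigl(J^n(\delta)^c\bigr)\le 2e^{-\theta n}. \] -/

import Mathlib

open MeasureTheory ProbabilityTheory

namespace BlockLCS

/-! ### Alignments and blocks of finite binary words -/

/-- An alignment of `x` and `y`, given by the set of pairs `(i, j)` such that the letter `x i` is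
aligned with the letter `y j`: aligned letters agree and the pairs are strictly increasing in both
coordinates. All other letters are aligned with gaps. The number of pairs is the length of the
common subsequence that the alignment defines. -/
def IsAlignment {m n : ℕ} (x : Fin m → Bool) (y : Fin n → Bool)
    (a : Finset (Fin m × Fin n)) : Prop :=
  (∀ p ∈ a, x p.1 = y p.2) ∧
    ∀ p ∈ a, ∀ q ∈ a, p ≠ q → (p.1 < q.1 ∧ p.2 < q.2) ∨ (q.1 < p.1 ∧ q.2 < p.2)

/-- An optimal alignment: its common subsequence is a longest common subsequence. -/
def IsOptimalAlignment {m n : ℕ} (x : Fin m → Bool) (y : Fin n → Bool)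
    (a : Finset (Fin m × Fin n)) : Prop :=
  IsAlignment x y a ∧ ∀ b : Finset (Fin m × Fin n), IsAlignment x y b → b.card ≤ a.card

/-- The block (maximal run of equal letters) of `x` containing position `k`, as a set of
positions. -/
def blockAt {n : ℕ} (x : Fin n → Bool) (k : Fin n) : Finset (Fin n) :=
  Finset.univ.filter fun j => ∀ i ∈ Finset.uIcc j k, x i = x k

/-- The set of all blocks of `x`. -/
def blocks {n : ℕ} (x : Fin n → Bool) : Finset (Finset (Fin n)) :=
  Finset.univ.image (blockAt x)

/-- The blocks of `x` that are left out at the end when `M` is the set of those positions of `x`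
that are not aligned with a gap: no letter of the block and no letter to the right of the block
is in `M`. -/
def leftOutAtEnd {n : ℕ} (x : Fin n → Bool) (M : Finset (Fin n)) : Finset (Finset (Fin n)) :=
  (blocks x).filter fun b => ∀ k ∈ b, ∀ j, k ≤ j → j ∉ M

/-- The proportion of blocks left out at the end, among all blocks of `x`. -/
noncomputable def propLeftOutAtEnd {n : ℕ} (x : Fin n → Bool) (M : Finset (Fin n)) : ℝ :=
  ((leftOutAtEnd x M).card : ℝ) / ((blocks x).card : ℝ)

/-- In every optimal alignment of `x` and `y`, the proportion of blocks left out at the end of `x`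
and the proportion of blocks left out at the end of `y` are both at most `δ`. -/
def FewLeftOutAtEnd (δ : ℝ) {m n : ℕ} (x : Fin m → Bool) (y : Fin n → Bool) : Prop :=
  ∀ a : Finset (Fin m × Fin n), IsOptimalAlignment x y a →
    propLeftOutAtEnd x (a.image Prod.fst) ≤ δ ∧ propLeftOutAtEnd y (a.image Prod.snd) ≤ δ

/-! ### The random binary sequences -/

/-- The index (from `0`) of the block containing position `k` (from `0`) in the infinite sequence
whose blocks have lengths `B 0, B 1, …`. -/
noncomputable def blockIndex (B : ℕ → ℕ) (k : ℕ) : ℕ :=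
  sInf {i | k < ∑ j ∈ Finset.range (i + 1), B j}

/-- The infinite binary sequence that is the concatenation of blocks of lengths `B 0, B 1, …`, the
letter of block `i` being `c` for even `i` and `!c` for odd `i`. -/
noncomputable def blockSeq (c : Bool) (B : ℕ → ℕ) (k : ℕ) : Bool :=
  xor c (decide (Odd (blockIndex B k)))

/-- The first `n` letters of that sequence. -/
noncomputable def blockWord (c : Bool) (B : ℕ → ℕ) (n : ℕ) : Fin n → Bool :=
  fun k => blockSeq c B k

/-- The data of one random sequence: the block lengths are i.i.d., uniform on `{l - 1, l, l + 1}`,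
and independent of the first letter, which is a fair bit. -/
structure IsBlockModel {Ω : Type*} [MeasurableSpace Ω] (P : Measure Ω) (l : ℕ)
    (c : Ω → Bool) (B : ℕ → Ω → ℕ) : Prop where
  measurable_c : Measurable c
  measurable_B : ∀ i, Measurable (B i)
  law_c : ∀ b : Bool, P {ω | c ω = b} = 1 / 2
  law_B : ∀ i, ∀ m ∈ ({l - 1, l, l + 1} : Set ℕ), P {ω | B i ω = m} = 1 / 3
  indep_B : iIndepFun B P
  indep_c : IndepFun c (fun ω i => B i ω) P

end BlockLCS

/-!
If an optimal alignment leaves out a proportion `δ` of the blocks of `X` at the end, then the first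
`a / (a + 1)` of the blocks of `X`, for a large `a` depending on `δ`, have essentially the same
longest common subsequence with `Y` as all of `X`. This is atypical because of a gap between means.
Let `u` be the mean length of a longest common subsequence of `2 a k` blocks and `2 (a + 1) k`
blocks, and let `g k` be its asymptotic value for `2 (a + 1) k` blocks on both sides. By
superadditivity, `q` pairs of the first kind and a single very unbalanced pair, with `9 (l + 1)`
times as many blocks in the first word, fit into `q + 1` balanced pairs. The longer word of the
unbalanced pair contains an alternating subsequence long enough to embed the whole shorter word, so
this pair contributes about `2 l k` more than `u` could ever do. Hence `u` is smaller than `g k` by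
a positive multiple of `k`. Block counts, word lengths and longest common subsequences are functions
of independent marks with bounded differences, so by McDiarmid's inequality they deviate from their
means by a small multiple of `k` only with exponentially small probability.
-/

open scoped NNReal

namespace BlockLCS

/-! ### Longest common subsequences of lists -/

section LCS

variable {α : Type*} {u u' v v' w : List α}

/-- The length of a longest common subsequence (not necessarily contiguous) of two lists. -/
noncomputable def lcs (u v : List α) : ℕ :=
  sSup {k | ∃ w : List α, w.Sublist u ∧ w.Sublist v ∧ w.length = k}

lemma bddAbove_length_common_sublist (u v : List α) :
    BddAbove {k | ∃ w : List α, w.Sublist u ∧ w.Sublist v ∧ w.length = k} := by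
  refine ⟨u.length, ?_⟩
  rintro k ⟨w, hwu, -, rfl⟩
  exact hwu.length_le

lemma length_le_lcs (hu : w.Sublist u) (hv : w.Sublist v) : w.length ≤ lcs u v :=
  le_csSup (bddAbove_length_common_sublist u v) ⟨w, hu, hv, rfl⟩

lemma exists_length_eq_lcs (u v : List α) :
    ∃ w : List α, w.Sublist u ∧ w.Sublist v ∧ w.length = lcs u v :=
  Nat.sSup_mem (s := {k | ∃ w : List α, w.Sublist u ∧ w.Sublist v ∧ w.length = k})
    ⟨0, [], u.nil_sublist, v.nil_sublist, rfl⟩ (bddAbove_length_common_sublist u v)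

lemma lcs_comm (u v : List α) : lcs u v = lcs v u := by
  simp only [lcs, and_left_comm]

lemma lcs_mono (hu : u.Sublist u') (hv : v.Sublist v') : lcs u v ≤ lcs u' v' := by
  obtain ⟨w, hwu, hwv, hw⟩ := exists_length_eq_lcs u v
  exact hw ▸ length_le_lcs (hwu.trans hu) (hwv.trans hv)

lemma lcs_le_length_left (u v : List α) : lcs u v ≤ u.length := by
  obtain ⟨w, hwu, -, hw⟩ := exists_length_eq_lcs u v
  exact hw ▸ hwu.length_le

lemma lcs_add_lcs_le_lcs_append (u u' v v' : List α) :
    lcs u v + lcs u' v' ≤ lcs (u ++ u') (v ++ v') := by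
  obtain ⟨w, hwu, hwv, hw⟩ := exists_length_eq_lcs u v
  obtain ⟨w', hwu', hwv', hw'⟩ := exists_length_eq_lcs u' v'
  rw [← hw, ← hw', ← List.length_append]
  exact length_le_lcs (hwu.append hwu') (hwv.append hwv')

lemma exists_common_sublist_length_add_le (hv : v.Sublist u) (hw : w.Sublist u) :
    ∃ r : List α, r.Sublist v ∧ r.Sublist w ∧ v.length + w.length ≤ r.length + u.length := by
  induction hv generalizing w with
  | slnil => exact ⟨[], by simp_all⟩
  | @cons v u a _ ih =>
    cases hw with
    | cons _ hw =>
      obtain ⟨r, hrv, hrw, hr⟩ := ih hw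
      exact ⟨r, hrv, hrw, hr.trans (by simp)⟩
    | @cons_cons w _ _ hw =>
      obtain ⟨r, hrv, hrw, hr⟩ := ih hw
      exact ⟨r, hrv, hrw.cons a, by simp only [List.length_cons]; omega⟩
  | @cons_cons v u a _ ih =>
    cases hw with
    | cons _ hw =>
      obtain ⟨r, hrv, hrw, hr⟩ := ih hw
      exact ⟨r, hrv.cons a, hrw, by simp only [List.length_cons]; omega⟩
    | @cons_cons w _ _ hw =>
      obtain ⟨r, hrv, hrw, hr⟩ := ih hw
      exact ⟨a :: r, hrv.cons_cons a, hrw.cons_cons a, by simp only [List.length_cons]; omega⟩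

lemma lcs_add_length_le (h : u'.Sublist u) (v : List α) :
    lcs u v + u'.length ≤ lcs u' v + u.length := by
  obtain ⟨w, hwu, hwv, hw⟩ := exists_length_eq_lcs u v
  obtain ⟨r, hrw, hru, hr⟩ := exists_common_sublist_length_add_le hwu h
  have := length_le_lcs hru (hrw.trans hwv)
  omega

lemma lcs_map_range_le_add {x y : ℕ → α} {m m' n n' : ℕ} {e e' : ℝ} (he : 0 ≤ e) (he' : 0 ≤ e')
    (hm : (m : ℝ) ≤ m' + e) (hn : (n : ℝ) ≤ n' + e') :
    (lcs ((List.range m).map x) ((List.range n).map y) : ℝ) ≤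
      lcs ((List.range m').map x) ((List.range n').map y) + e + e' := by
  have shorten_left {x : ℕ → α} {m m' : ℕ} {e : ℝ} (he : 0 ≤ e) (hm : (m : ℝ) ≤ m' + e)
      (v : List α) :
      (lcs ((List.range m).map x) v : ℝ) ≤ lcs ((List.range m').map x) v + e := by
    rcases le_total m m' with hmm' | hmm'
    · refine le_add_of_le_of_nonneg (Nat.cast_le.2 (lcs_mono ?_ (List.Sublist.refl v))) he
      exact (List.range_sublist.2 hmm').map x
    · have hlip := lcs_add_length_le ((List.range_sublist.2 hmm').map x) v
      simp only [List.length_map, List.length_range] at hlip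
      rify at hlip
      linarith
  calc (lcs ((List.range m).map x) ((List.range n).map y) : ℝ)
      ≤ lcs ((List.range m').map x) ((List.range n).map y) + e := shorten_left he hm _
    _ ≤ lcs ((List.range m').map x) ((List.range n').map y) + e' + e := by
        rw [lcs_comm _ ((List.range n).map y), lcs_comm _ ((List.range n').map y)]
        exact add_le_add_left (shorten_left he' hn _) e
    _ = lcs ((List.range m').map x) ((List.range n').map y) + e + e' := add_right_comm _ _ _

end LCS

/-! ### Words with given block lengths -/

section Words

variable {c : Bool} {B : ℕ → ℕ}

/-- The concatenation of the first `N` blocks of `blockSeq c B`, empty blocks being counted. -/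
def firstBlocks (c : Bool) (B : ℕ → ℕ) (N : ℕ) : List Bool :=
  (List.range N).flatMap fun i => List.replicate (B i) (xor c (decide (Odd i)))

lemma firstBlocks_succ (c : Bool) (B : ℕ → ℕ) (N : ℕ) :
    firstBlocks c B (N + 1) =
      firstBlocks c B N ++ List.replicate (B N) (xor c (decide (Odd N))) := by
  simp [firstBlocks, List.range_succ]

lemma length_firstBlocks (c : Bool) (B : ℕ → ℕ) (N : ℕ) :
    (firstBlocks c B N).length = ∑ i ∈ Finset.range N, B i := by
  induction N with
  | zero => rfl
  | succ N ih => simp [firstBlocks_succ, ih, Finset.sum_range_succ]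

lemma firstBlocks_add (c : Bool) (B : ℕ → ℕ) {M : ℕ} (hM : Even M) (N : ℕ) :
    firstBlocks c B (M + N) = firstBlocks c B M ++ firstBlocks c (fun i => B (M + i)) N := by
  have hodd (i : ℕ) : Odd (M + i) ↔ Odd i := by grind
  simp only [firstBlocks, List.range_add, List.flatMap_append, List.flatMap_map, hodd]

lemma firstBlocks_sublist {B' : ℕ → ℕ} (c : Bool) (h : ∀ i, B i ≤ B' i) (N : ℕ) :
    (firstBlocks c B N).Sublist (firstBlocks c B' N) := by
  induction N with
  | zero => exact List.Sublist.refl _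
  | succ N ih =>
    simp only [firstBlocks_succ]
    exact ih.append (List.replicate_sublist_replicate _ |>.2 (h N))

lemma lcs_firstBlocks_le_add (c : Bool) (B B' : ℕ → ℕ) (N : ℕ) (v : List Bool) :
    lcs (firstBlocks c B N) v ≤
      lcs (firstBlocks c B' N) v + ∑ i ∈ Finset.range N, (B i - B' i) := by
  have hlip := lcs_add_length_le
    (firstBlocks_sublist c (B := fun i => min (B i) (B' i)) (fun i => min_le_left _ _) N) v
  have hmono := lcs_mono
    (firstBlocks_sublist c (B := fun i => min (B i) (B' i)) (fun i => min_le_right _ _) N)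
    (List.Sublist.refl v)
  have hsum : ∑ i ∈ Finset.range N, B i =
      ∑ i ∈ Finset.range N, min (B i) (B' i) + ∑ i ∈ Finset.range N, (B i - B' i) := by
    rw [← Finset.sum_add_distrib]
    exact Finset.sum_congr rfl fun i _ => by omega
  rw [length_firstBlocks, length_firstBlocks] at hlip
  omega

lemma blockIndex_eq {i k : ℕ} (hle : ∑ j ∈ Finset.range i, B j ≤ k)
    (hlt : k < ∑ j ∈ Finset.range (i + 1), B j) : blockIndex B k = i := by
  refine le_antisymm (Nat.sInf_le hlt) (le_csInf ⟨i, hlt⟩ fun j (hj : k < _) => ?_)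
  by_contra! hji
  have hmono : ∑ t ∈ Finset.range (j + 1), B t ≤ ∑ t ∈ Finset.range i, B t :=
    Finset.sum_le_sum_of_subset (Finset.range_mono hji)
  omega

lemma firstBlocks_eq_map_blockSeq (c : Bool) (B : ℕ → ℕ) (N : ℕ) :
    firstBlocks c B N = (List.range (∑ i ∈ Finset.range N, B i)).map (blockSeq c B) := by
  induction N with
  | zero => rfl
  | succ N ih =>
    rw [firstBlocks_succ, ih, Finset.sum_range_succ, List.range_add, List.map_append]
    congr 1
    symm
    rw [List.eq_replicate_iff]
    refine ⟨by simp, ?_⟩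
    simp only [List.map_map, List.mem_map, List.mem_range]
    rintro _ ⟨k, hk, rfl⟩
    rw [Function.comp_apply, blockSeq, blockIndex_eq (Nat.le_add_right _ k)]
    rw [Finset.sum_range_succ]
    omega

lemma ofFn_blockWord (c : Bool) (B : ℕ → ℕ) (n : ℕ) :
    List.ofFn (blockWord c B n) = (List.range n).map (blockSeq c B) := by
  refine List.ext_getElem (by simp) fun k hk hk' => ?_
  simp [blockWord]

/-! ### Alternating subsequences -/

/-- The number of nonempty minus the number of empty blocks, among the first `N`. An empty block
merges its two neighbours, so this is a lower bound on the number of maximal runs. -/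
def excess (B : ℕ → ℕ) (N : ℕ) : ℤ :=
  ∑ i ∈ Finset.range N, if B i = 0 then -1 else 1

lemma exists_isChain_ne_sublist_firstBlocks (c : Bool) (B : ℕ → ℕ) (N : ℕ) :
    ∃ v : List Bool, v.IsChain (· ≠ ·) ∧ v.Sublist (firstBlocks c B N) ∧
      excess B N ≤ v.length := by
  suffices h : ∃ v : List Bool, (v ++ [xor c (decide (Odd N))]).IsChain (· ≠ ·) ∧
      v.Sublist (firstBlocks c B N) ∧ excess B N ≤ v.length by
    obtain ⟨v, hchain, hsub, hlen⟩ := h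
    exact ⟨v, hchain.left_of_append, hsub, hlen⟩
  induction N with
  | zero => exact ⟨[], by simp, List.Sublist.refl _, by simp [excess]⟩
  | succ N ih =>
    obtain ⟨v, hchain, hsub, hlen⟩ := ih
    have hexcess : excess B (N + 1) = excess B N + if B N = 0 then -1 else 1 :=
      Finset.sum_range_succ _ N
    set d := xor c (decide (Odd N)) with hd
    have hnext : xor c (decide (Odd (N + 1))) = !d := by grind
    rw [hnext, hexcess, firstBlocks_succ, ← hd]
    rcases Nat.eq_zero_or_pos (B N) with hBN | hBN
    · rcases v.eq_nil_or_concat with rfl | ⟨v, b, rfl⟩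
      · exact ⟨[], by simp, List.nil_sublist _, by simp_all; omega⟩
      · simp only [List.concat_eq_append] at hchain hsub hlen
        rw [List.append_assoc] at hchain
        obtain ⟨hchain, hbd, -⟩ := List.isChain_append_cons_cons.1 hchain
        rw [← Bool.eq_not.2 hbd]
        refine ⟨v, hchain, ?_, ?_⟩
        · simpa [hBN] using (List.sublist_append_left v [b]).trans hsub
        · simp only [List.length_append, List.length_singleton, Nat.cast_add, Nat.cast_one] at hlen
          simp only [hBN, if_true]
          omega
    · refine ⟨v ++ [d], ?_, ?_, ?_⟩
      · rw [List.append_assoc]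
        exact List.isChain_append_cons_cons.2
          ⟨hchain, (Bool.not_ne_self d).symm, List.isChain_singleton _⟩
      · exact hsub.append (by simpa using hBN.ne')
      · simp [hBN.ne', hlen]

lemma sublist_of_isChain_ne {v w : List Bool} (hv : v.IsChain (· ≠ ·))
    (h : 2 * w.length ≤ v.length) : w.Sublist v := by
  induction w generalizing v with
  | nil => exact v.nil_sublist
  | cons a w ih =>
    match v, h with
    | b :: d :: v, h =>
      rw [List.isChain_cons_cons] at hv
      have hwv : w.Sublist v := ih hv.2.of_cons (by simp at h; omega)
      rcases eq_or_ne a b with rfl | hab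
      · exact (hwv.cons d).cons_cons a
      · obtain rfl : a = d := by
          rw [Bool.eq_not.2 hab, Bool.eq_not.2 hv.1, Bool.not_not]
        exact (hwv.cons_cons a).cons b

lemma sum_le_lcs_firstBlocks_of_le_excess (c c' : Bool) {B B' : ℕ → ℕ} {M N : ℕ}
    (h : 2 * ((∑ i ∈ Finset.range N, B' i : ℕ) : ℤ) ≤ excess B M) :
    ∑ i ∈ Finset.range N, B' i ≤ lcs (firstBlocks c B M) (firstBlocks c' B' N) := by
  obtain ⟨v, hchain, hsub, hlen⟩ := exists_isChain_ne_sublist_firstBlocks c B M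
  rw [← length_firstBlocks c'] at h ⊢
  exact length_le_lcs ((sublist_of_isChain_ne hchain (by omega)).trans hsub)
    (List.Sublist.refl _)

end Words

/-! ### Alignments and blocks -/

section Alignments

variable {m n : ℕ} {x : Fin m → Bool} {y : Fin n → Bool} {a : Finset (Fin m × Fin n)}

lemma exists_strictMono_of_sublist_ofFn {w : List Bool} (h : w.Sublist (List.ofFn x)) :
    ∃ f : Fin w.length → Fin m, StrictMono f ∧ ∀ j, w.get j = x (f j) := by
  obtain ⟨f, hf⟩ := List.sublist_iff_exists_fin_orderEmbedding_get_eq.1 h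
  refine ⟨fun j => Fin.cast List.length_ofFn (f j), fun _ _ hij => f.strictMono hij, fun j => ?_⟩
  rw [hf j, List.get_eq_getElem, List.getElem_ofFn]
  rfl

lemma ofFn_comp_sublist_take {k : ℕ} {f : Fin k → Fin m} (hf : StrictMono f) {i : ℕ}
    (hi : ∀ j, (f j : ℕ) < i) : (List.ofFn (x ∘ f)).Sublist ((List.ofFn x).take i) := by
  have hlen : (List.ofFn (x ∘ f)).length = k := List.length_ofFn
  have hlt (j : Fin k) : (f j : ℕ) < ((List.ofFn x).take i).length := by simpa using hi j
  rw [List.sublist_iff_exists_fin_orderEmbedding_get_eq]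
  refine ⟨OrderEmbedding.ofStrictMono (fun j => ⟨f (Fin.cast hlen j), hlt _⟩)
    fun _ _ hij => hf hij, fun j => ?_⟩
  simp [Fin.cast]

lemma IsAlignment.card_le_lcs_take (ha : IsAlignment x y a) {i : ℕ}
    (hi : ∀ p ∈ a, (p.1 : ℕ) < i) :
    a.card ≤ lcs ((List.ofFn x).take i) (List.ofFn y) := by
  have hinj : Set.InjOn Prod.fst (a : Set (Fin m × Fin n)) := by
    intro p hp q hq hpq
    by_contra hne
    rcases ha.2 p hp q hq hne with h | h
    · exact h.1.ne hpq
    · exact h.1.ne hpq.symm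
  set e := (a.image Prod.fst).orderEmbOfFin (Finset.card_image_of_injOn hinj)
  have hmem (j : Fin a.card) : ∃ p ∈ a, p.1 = e j :=
    Finset.mem_image.1 (Finset.orderEmbOfFin_mem _ _ j)
  choose p hp hpe using hmem
  have snd_strictMono : StrictMono fun j => (p j).2 := by
    intro j j' hjj'
    have hlt : (p j).1 < (p j').1 := by
      rw [hpe, hpe]
      exact e.strictMono hjj'
    rcases ha.2 _ (hp j) _ (hp j') (ne_of_apply_ne Prod.fst hlt.ne) with h | h
    · exact h.2
    · exact absurd h.1 hlt.asymm
  have hletters : x ∘ e = y ∘ fun j => (p j).2 := by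
    funext j
    rw [Function.comp_apply, Function.comp_apply, ← hpe j, ha.1 _ (hp j)]
  have hx : (List.ofFn (x ∘ e)).Sublist ((List.ofFn x).take i) :=
    ofFn_comp_sublist_take e.strictMono fun j => hpe j ▸ hi _ (hp j)
  have hy : (List.ofFn (x ∘ e)).Sublist (List.ofFn y) := by
    rw [hletters]
    exact (ofFn_comp_sublist_take snd_strictMono fun j => (p j).2.2).trans (List.take_sublist _ _)
  simpa using length_le_lcs hx hy

lemma exists_isAlignment_card_eq_lcs (x : Fin m → Bool) (y : Fin n → Bool) :
    ∃ b : Finset (Fin m × Fin n), IsAlignment x y b ∧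
      b.card = lcs (List.ofFn x) (List.ofFn y) := by
  obtain ⟨w, hx, hy, hw⟩ := exists_length_eq_lcs (List.ofFn x) (List.ofFn y)
  obtain ⟨f, hf, hfx⟩ := exists_strictMono_of_sublist_ofFn hx
  obtain ⟨g, hg, hgy⟩ := exists_strictMono_of_sublist_ofFn hy
  have hinj : Function.Injective fun j => (f j, g j) :=
    fun _ _ h => hf.injective (congrArg Prod.fst h)
  refine ⟨Finset.univ.image fun j => (f j, g j), ⟨?_, ?_⟩, ?_⟩
  · simp only [Finset.mem_image, Finset.mem_univ, true_and]
    rintro _ ⟨j, rfl⟩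
    exact (hfx j).symm.trans (hgy j)
  · simp only [Finset.mem_image, Finset.mem_univ, true_and]
    rintro _ ⟨j, rfl⟩ _ ⟨j', rfl⟩ hne
    rcases lt_trichotomy j j' with h | rfl | h
    · exact .inl ⟨hf h, hg h⟩
    · exact absurd rfl hne
    · exact .inr ⟨hf h, hg h⟩
  · rw [Finset.card_image_of_injective _ hinj, Finset.card_univ, Fintype.card_fin, hw]

lemma IsAlignment.swap (ha : IsAlignment x y a) : IsAlignment y x (a.image Prod.swap) := by
  simp only [IsAlignment, Finset.mem_image]
  constructor
  · rintro _ ⟨p, hp, rfl⟩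
    exact (ha.1 p hp).symm
  · rintro _ ⟨p, hp, rfl⟩ _ ⟨q, hq, rfl⟩ hne
    exact (ha.2 p hp q hq (ne_of_apply_ne Prod.swap hne)).imp And.symm And.symm

lemma IsOptimalAlignment.swap (ha : IsOptimalAlignment x y a) :
    IsOptimalAlignment y x (a.image Prod.swap) := by
  refine ⟨ha.1.swap, fun b hb => ?_⟩
  simpa only [Finset.card_image_of_injective _ Prod.swap_injective] using ha.2 _ hb.swap

lemma mem_blockAt_self (x : Fin m → Bool) (k : Fin m) : k ∈ blockAt x k := by
  simpa [blockAt] using fun i hki hik => congrArg x (le_antisymm hik hki)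

lemma length_le_card_blocks {v : List Bool} (hv : v.IsChain (· ≠ ·))
    (h : v.Sublist (List.ofFn x)) : v.length ≤ (blocks x).card := by
  obtain ⟨f, hf, hfx⟩ := exists_strictMono_of_sublist_ofFn h
  have hne {j j' : Fin v.length} (hjj' : j < j') : blockAt x (f j) ≠ blockAt x (f j') := by
    intro heq
    have hsucc : (j : ℕ) + 1 < v.length := by omega
    have hmem : f j' ∈ blockAt x (f j) := heq ▸ mem_blockAt_self x (f j')
    have hbetween : f ⟨j + 1, hsucc⟩ ∈ Finset.uIcc (f j') (f j) := by
      rw [Finset.uIcc_of_ge (hf hjj').le, Finset.mem_Icc]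
      exact ⟨hf.monotone (Nat.le_succ (j : ℕ)), hf.monotone hjj'⟩
    have hletter := (Finset.mem_filter.1 hmem).2 _ hbetween
    rw [← hfx, ← hfx] at hletter
    exact (List.isChain_iff_getElem.1 hv j hsucc) hletter.symm
  have hinj : Function.Injective fun j => blockAt x (f j) := by
    intro j j' heq
    by_contra hjj'
    rcases lt_or_gt_of_ne hjj' with hlt | hlt
    · exact hne hlt heq
    · exact hne hlt heq.symm
  simpa using Finset.card_le_card_of_injOn (s := Finset.univ) (t := blocks x) _
    (fun j _ => Finset.mem_image_of_mem _ (Finset.mem_univ (f j))) hinj.injOn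

lemma card_leftOutAtEnd_le {M : Finset (Fin m)} {i : ℕ}
    (hi : ∀ k : Fin m, (∀ j, k ≤ j → j ∉ M) → i ≤ k) :
    (leftOutAtEnd x M).card ≤ m - i := by
  have hsub : leftOutAtEnd x M ⊆
      (Finset.univ.filter fun k : Fin m => i ≤ (k : ℕ)).image (blockAt x) := by
    intro b hb
    obtain ⟨hblock, hout⟩ := Finset.mem_filter.1 hb
    obtain ⟨k, -, rfl⟩ := Finset.mem_image.1 hblock
    exact Finset.mem_image_of_mem _ (by simpa using hi k (hout k (mem_blockAt_self x k)))
  refine ((Finset.card_le_card hsub).trans Finset.card_image_le).trans ?_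
  rw [← Nat.card_Ico]
  exact Finset.card_le_card_of_injOn Fin.val (fun k hk => by simpa using hk)
    Fin.val_injective.injOn

lemma IsOptimalAlignment.exists_lcs_le_lcs_take (ha : IsOptimalAlignment x y a) :
    ∃ i : ℕ, i + (leftOutAtEnd x (a.image Prod.fst)).card ≤ m ∧
      lcs (List.ofFn x) (List.ofFn y) ≤ lcs ((List.ofFn x).take i) (List.ofFn y) := by
  set i := a.sup fun p => (p.1 : ℕ) + 1
  have him : i ≤ m := Finset.sup_le fun p _ => p.1.2
  have hout : (leftOutAtEnd x (a.image Prod.fst)).card ≤ m - i := by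
    refine card_leftOutAtEnd_le fun k hk => Finset.sup_le fun p hp => ?_
    by_contra hlt
    exact hk p.1 (by omega) (Finset.mem_image_of_mem _ hp)
  refine ⟨i, by omega, ?_⟩
  obtain ⟨b, hb, hcard⟩ := exists_isAlignment_card_eq_lcs x y
  calc lcs (List.ofFn x) (List.ofFn y) = b.card := hcard.symm
    _ ≤ a.card := ha.2 b hb
    _ ≤ lcs ((List.ofFn x).take i) (List.ofFn y) := ha.1.card_le_lcs_take fun p hp =>
        Finset.le_sup (f := fun p : Fin m × Fin n => (p.1 : ℕ) + 1) hp

/-- Some optimal alignment leaves out more than the proportion `δ` of the blocks of `x` at the end: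
the failure of `FewLeftOutAtEnd` on the side of `x`. -/
def ManyLeftOutAtEnd (δ : ℝ) {m n : ℕ} (x : Fin m → Bool) (y : Fin n → Bool) : Prop :=
  ∃ a : Finset (Fin m × Fin n), IsOptimalAlignment x y a ∧
    δ < propLeftOutAtEnd x (a.image Prod.fst)

lemma ManyLeftOutAtEnd.exists_lcs_le_lcs_take {δ : ℝ} (h : ManyLeftOutAtEnd δ x y) :
    ∃ i : ℕ, i + δ * (blocks x).card ≤ m ∧
      lcs (List.ofFn x) (List.ofFn y) ≤ lcs ((List.ofFn x).take i) (List.ofFn y) := by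
  obtain ⟨a, ha, hδ⟩ := h
  obtain ⟨i, him, hlcs⟩ := ha.exists_lcs_le_lcs_take
  refine ⟨i, ?_, hlcs⟩
  have hleft : δ * (blocks x).card ≤ (leftOutAtEnd x (a.image Prod.fst)).card := by
    rcases (blocks x).card.eq_zero_or_pos with h0 | hpos
    · simp [h0]
    · exact ((lt_div_iff₀ (Nat.cast_pos.2 hpos)).1 hδ).le
  have : ((i + (leftOutAtEnd x (a.image Prod.fst)).card : ℕ) : ℝ) ≤ m := Nat.cast_le.2 him
  push_cast at this
  linarith

lemma manyLeftOutAtEnd_of_not_few {δ : ℝ} (h : ¬ FewLeftOutAtEnd δ x y) :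
    ManyLeftOutAtEnd δ x y ∨ ManyLeftOutAtEnd δ y x := by
  simp only [FewLeftOutAtEnd, not_forall, not_and_or, not_le] at h
  obtain ⟨a, ha, hfst | hsnd⟩ := h
  · exact .inl ⟨a, ha, hfst⟩
  · refine .inr ⟨a.image Prod.swap, ha.swap, ?_⟩
    rwa [Finset.image_image,
      show Prod.fst ∘ Prod.swap = (Prod.snd : Fin m × Fin n → Fin n) from rfl]

end Alignments

section BlockWords

variable {c c' : Bool} {B B' : ℕ → ℕ} {n : ℕ}

lemma excess_le_card_blocks_blockWord {A : ℕ} (h : ∑ i ∈ Finset.range A, B i ≤ n) :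
    excess B A ≤ (blocks (blockWord c B n)).card := by
  obtain ⟨v, hv, hsub, hlen⟩ := exists_isChain_ne_sublist_firstBlocks c B A
  refine hlen.trans (Nat.cast_le.2 (length_le_card_blocks hv (hsub.trans ?_)))
  rw [firstBlocks_eq_map_blockSeq, ofFn_blockWord]
  exact (List.range_sublist.2 h).map _

-- An optimal alignment leaving out many blocks at the end would essentially align only the first
-- `A` blocks of the first word.
lemma not_manyLeftOutAtEnd_blockWord {A N : ℕ} {δ ρ : ℝ} (hδ : 0 ≤ δ) (hρ : 0 ≤ ρ)
    (hA : ∑ i ∈ Finset.range A, B i ≤ n)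
    (hnA : (n : ℝ) ≤ (∑ i ∈ Finset.range A, B i : ℕ) + δ * excess B A + ρ)
    (hN : ((∑ i ∈ Finset.range N, B i : ℕ) : ℝ) ≤ n + ρ)
    (hN' : |((∑ i ∈ Finset.range N, B' i : ℕ) : ℝ) - n| ≤ ρ)
    (hgap : (lcs (firstBlocks c B A) (firstBlocks c' B' N) : ℝ) + 4 * ρ <
      lcs (firstBlocks c B N) (firstBlocks c' B' N)) :
    ¬ ManyLeftOutAtEnd δ (blockWord c B n) (blockWord c' B' n) := by
  intro h
  obtain ⟨i, hi, hlcs⟩ := h.exists_lcs_le_lcs_take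
  have hexcess : δ * excess B A ≤ δ * (blocks (blockWord c B n)).card := by
    gcongr
    exact_mod_cast excess_le_card_blocks_blockWord hA
  have hin : i ≤ n := by
    have : (0 : ℝ) ≤ δ * (blocks (blockWord c B n)).card := by positivity
    exact_mod_cast (by linarith : (i : ℝ) ≤ n)
  rw [ofFn_blockWord, ofFn_blockWord, ← List.map_take, List.take_range, min_eq_left hin] at hlcs
  obtain ⟨hnN', hN'n⟩ := abs_le.1 hN'
  simp only [firstBlocks_eq_map_blockSeq] at hgap
  refine hgap.not_ge ?_
  set X := blockSeq c B
  set Y := blockSeq c' B'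
  set L : ℕ → ℕ → ℝ := fun i j => lcs ((List.range i).map X) ((List.range j).map Y)
  calc L (∑ i ∈ Finset.range N, B i) (∑ i ∈ Finset.range N, B' i)
      ≤ L n n + ρ + ρ :=
        lcs_map_range_le_add hρ hρ (by linarith) (by linarith)
    _ ≤ L i n + ρ + ρ := by gcongr; exact Nat.cast_le.2 hlcs
    _ ≤ L (∑ i ∈ Finset.range A, B i) (∑ i ∈ Finset.range N, B' i) + ρ + ρ + ρ + ρ := by
        gcongr ?_ + ρ + ρ
        exact lcs_map_range_le_add hρ hρ (by linarith) (by linarith)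
    _ = L (∑ i ∈ Finset.range A, B i) (∑ i ∈ Finset.range N, B' i) + 4 * ρ := by ring

end BlockWords

/-! ### Bounded differences -/

section Subgaussian

variable {α β : Type*} [MeasurableSpace α] [MeasurableSpace β]

lemma hasSubgaussianMGF_add_prod {μ : Measure α} {ν : Measure β} [SFinite μ] [SFinite ν]
    {X : α → ℝ} {Y : α → β → ℝ} {cX cY : ℝ≥0} (hX : HasSubgaussianMGF X cX μ)
    (hY : ∀ x, HasSubgaussianMGF (Y x) cY ν)
    (hYm : AEMeasurable (Function.uncurry Y) (μ.prod ν)) :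
    HasSubgaussianMGF (fun p : α × β => X p.1 + Y p.1 p.2) (cX + cY) (μ.prod ν) := by
  have section_exp (t : ℝ) (x : α) (y : β) :
      Real.exp (t * (X x + Y x y)) = Real.exp (t * X x) * Real.exp (t * Y x y) := by
    rw [← Real.exp_add, mul_add]
  have integral_section_le (t : ℝ) (x : α) :
      ∫ y, Real.exp (t * (X x + Y x y)) ∂ν ≤ Real.exp (t * X x) * Real.exp (cY * t ^ 2 / 2) := by
    simp only [section_exp, integral_const_mul]
    exact mul_le_mul_of_nonneg_left ((hY x).mgf_le t) (Real.exp_nonneg _)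
  have integrable_exp (t : ℝ) :
      Integrable (fun p : α × β => Real.exp (t * (X p.1 + Y p.1 p.2))) (μ.prod ν) := by
    have hm : AEStronglyMeasurable (fun p : α × β => Real.exp (t * (X p.1 + Y p.1 p.2)))
        (μ.prod ν) :=
      (Real.measurable_exp.comp_aemeasurable
        ((hX.aemeasurable.comp_fst.add hYm).const_mul t)).aestronglyMeasurable
    refine (integrable_prod_iff hm).2 ⟨.of_forall fun x => ?_, ?_⟩
    · simp only [section_exp]
      exact ((hY x).integrable_exp_mul t).const_mul _
    · refine ((hX.integrable_exp_mul t).mul_const (Real.exp (cY * t ^ 2 / 2))).mono'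
        hm.norm.integral_prod_right' (.of_forall fun x => ?_)
      simp only [Real.norm_eq_abs, Real.abs_exp]
      rw [abs_of_nonneg (integral_nonneg fun y => Real.exp_nonneg _)]
      exact integral_section_le t x
  refine ⟨integrable_exp, fun t => ?_⟩
  calc mgf (fun p : α × β => X p.1 + Y p.1 p.2) (μ.prod ν) t
      = ∫ x, ∫ y, Real.exp (t * (X x + Y x y)) ∂ν ∂μ := integral_prod _ (integrable_exp t)
    _ ≤ ∫ x, Real.exp (t * X x) * Real.exp (cY * t ^ 2 / 2) ∂μ :=
        integral_mono (integrable_exp t).integral_prod_left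
          ((hX.integrable_exp_mul t).mul_const _) (integral_section_le t)
    _ ≤ Real.exp (cX * t ^ 2 / 2) * Real.exp (cY * t ^ 2 / 2) := by
        rw [integral_mul_const]
        exact mul_le_mul_of_nonneg_right (hX.mgf_le t) (Real.exp_nonneg _)
    _ = Real.exp ((cX + cY : ℝ≥0) * t ^ 2 / 2) := by
        rw [← Real.exp_add]
        push_cast
        ring_nf

lemma hasSubgaussianMGF_sub_integral_of_le_add {ν : Measure β} [IsProbabilityMeasure ν]
    {g : β → ℝ} {d : ℝ≥0} (hg : AEMeasurable g ν) (hd : ∀ a b, g a ≤ g b + d) :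
    HasSubgaussianMGF (fun a => g a - ∫ b, g b ∂ν) ((d / 2) ^ 2) ν := by
  have : Nonempty β := nonempty_of_isProbabilityMeasure ν
  have hbdd : BddBelow (Set.range g) :=
    ⟨g (Classical.arbitrary β) - d, by rintro _ ⟨a, rfl⟩; exact sub_le_iff_le_add.2 (hd _ a)⟩
  have hmem : ∀ a, g a ∈ Set.Icc (⨅ b, g b) ((⨅ b, g b) + d) := fun a =>
    ⟨ciInf_le hbdd a, sub_le_iff_le_add.1 (le_ciInf fun b => sub_le_iff_le_add.2 (hd a b))⟩
  simpa using hasSubgaussianMGF_of_mem_Icc hg (.of_forall hmem)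

end Subgaussian

section BoundedDifferences

variable {ι : Type*} {α : ι → Type*}

open scoped Classical in
/-- The bounded differences property on the coordinates in `s`: changing coordinates changes `f` by
at most the sum of `c i` over the changed `i ∈ s`. In particular, `f` does not depend on the
coordinates outside `s`, of which there may be infinitely many. -/
def HasBoundedDifferences (f : (∀ i, α i) → ℝ) (s : Finset ι) (c : ι → ℝ≥0) : Prop :=
  ∀ x y, f x ≤ f y + ∑ i ∈ s with x i ≠ y i, (c i : ℝ)

variable {f : (∀ i, α i) → ℝ} {s : Finset ι} {c : ι → ℝ≥0}

lemma HasBoundedDifferences.update_le [DecidableEq ι] {i : ι} (h : HasBoundedDifferences f s c)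
    (x : ∀ i, α i) (a b : α i) :
    f (Function.update x i a) ≤ f (Function.update x i b) + c i := by
  classical
  refine (h _ _).trans (add_le_add_right ?_ _)
  calc ∑ j ∈ s with Function.update x i a j ≠ Function.update x i b j, (c j : ℝ)
      ≤ ∑ j ∈ {i}, (c j : ℝ) := by
        refine Finset.sum_le_sum_of_subset_of_nonneg (fun j hj => ?_) fun j _ _ => (c j).2
        by_contra hji
        simp_all [Function.update_of_ne]
    _ = c i := Finset.sum_singleton _ _

lemma HasBoundedDifferences.le_add_sum (h : HasBoundedDifferences f s c) (x y : ∀ i, α i) :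
    f x ≤ f y + ∑ i ∈ s, (c i : ℝ) := by
  classical
  exact (h x y).trans (add_le_add_right
    (Finset.sum_le_sum_of_subset_of_nonneg (Finset.filter_subset _ _) fun j _ _ => (c j).2) _)

lemma HasBoundedDifferences.dependsOn (h : HasBoundedDifferences f s c) : DependsOn f s := by
  classical
  have hle {x y : ∀ i, α i} (hxy : ∀ i ∈ s, x i = y i) : f x ≤ f y := by
    refine (h x y).trans_eq ?_
    rw [Finset.filter_false_of_mem fun i hi => not_not.2 (hxy i hi), Finset.sum_empty, add_zero]
  exact fun x y hxy => le_antisymm (hle hxy) (hle fun i hi => (hxy i hi).symm)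

variable [∀ i, MeasurableSpace (α i)] {μ : ∀ i, Measure (α i)} [∀ i, IsProbabilityMeasure (μ i)]

lemma HasBoundedDifferences.integrable (h : HasBoundedDifferences f s c) (hf : Measurable f)
    (ν : Measure (∀ i, α i)) [IsFiniteMeasure ν] : Integrable f ν := by
  rcases isEmpty_or_nonempty (∀ i, α i) with hα | ⟨⟨y⟩⟩
  · exact Integrable.of_isEmpty
  · exact Integrable.of_mem_Icc (f y - ∑ i ∈ s, (c i : ℝ)) (f y + ∑ i ∈ s, (c i : ℝ))
      hf.aemeasurable
      (.of_forall fun x => ⟨sub_le_iff_le_add.2 (h.le_add_sum y x), h.le_add_sum x y⟩)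

lemma HasBoundedDifferences.integrable_update [DecidableEq ι] {i : ι}
    (h : HasBoundedDifferences f s c) (hf : Measurable f) (x : ∀ j, α j) :
    Integrable (fun a => f (Function.update x i a)) (μ i) :=
  (h.integrable hf _).comp_measurable (measurable_update x)

lemma HasBoundedDifferences.integral_update [DecidableEq ι] {i : ι}
    (h : HasBoundedDifferences f (insert i s) c) (hi : i ∉ s) (hf : Measurable f) :
    HasBoundedDifferences (fun x => ∫ a, f (Function.update x i a) ∂μ i) s c := by
  classical
  intro x y
  have hxy (a : α i) : f (Function.update x i a) ≤
      f (Function.update y i a) + ∑ j ∈ s with x j ≠ y j, (c j : ℝ) := by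
    refine (h _ _).trans (add_le_add_right (Finset.sum_le_sum_of_subset_of_nonneg ?_
      fun j _ _ => (c j).2) _)
    intro j hj
    by_cases hji : j = i
    · subst hji
      simp at hj
    · simpa [hji] using hj
  calc ∫ a, f (Function.update x i a) ∂μ i
      ≤ ∫ a, (f (Function.update y i a) + ∑ j ∈ s with x j ≠ y j, (c j : ℝ)) ∂μ i :=
        integral_mono (h.integrable_update hf x)
          ((h.integrable_update hf y).add (integrable_const _)) hxy
    _ = ∫ a, f (Function.update y i a) ∂μ i + ∑ j ∈ s with x j ≠ y j, (c j : ℝ) := by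
        rw [integral_add (h.integrable_update hf y) (integrable_const _), integral_const,
          probReal_univ, one_smul]

lemma measurePreserving_update_infinitePi [DecidableEq ι] (i : ι) :
    MeasurePreserving (fun p : (∀ j, α j) × α i => Function.update p.1 i p.2)
      ((Measure.infinitePi μ).prod (μ i)) (Measure.infinitePi μ) := by
  refine ⟨measurable_update', Measure.eq_infinitePi μ fun s t ht => ?_⟩
  have hpre : (fun p : (∀ j, α j) × α i => Function.update p.1 i p.2) ⁻¹' Set.pi s t =
      (Set.pi (s.erase i) t) ×ˢ {a | i ∈ s → a ∈ t i} := by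
    ext p
    constructor
    · intro hp
      refine ⟨fun j hj => ?_, fun hi => by simpa using hp i hi⟩
      simpa [Finset.ne_of_mem_erase hj] using hp j (Finset.mem_of_mem_erase hj)
    · rintro ⟨hp, hpi⟩ j hj
      by_cases hji : j = i
      · subst hji
        simpa using hpi hj
      · simpa [hji] using hp j (Finset.mem_erase.2 ⟨hji, hj⟩)
  rw [Measure.map_apply measurable_update' (.pi s.countable_toSet fun j _ => ht j), hpre,
    Measure.prod_prod, Measure.infinitePi_pi μ fun j _ => ht j]
  by_cases hi : i ∈ s
  · simp [hi, Finset.prod_erase_mul]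
  · simp [hi]

-- McDiarmid's inequality for the moment generating function: average out one coordinate at a time.
lemma HasBoundedDifferences.hasSubgaussianMGF (h : HasBoundedDifferences f s c)
    (hf : Measurable f) :
    HasSubgaussianMGF (fun x => f x - ∫ y, f y ∂Measure.infinitePi μ) (∑ i ∈ s, (c i / 2) ^ 2)
      (Measure.infinitePi μ) := by
  classical
  induction s using Finset.induction_on generalizing f with
  | empty =>
    have hconst (x y : ∀ i, α i) : f x ≤ f y + (0 : ℝ≥0) := by simpa using h x y
    simpa using hasSubgaussianMGF_sub_integral_of_le_add hf.aemeasurable hconst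
  | insert i s hi ih =>
    set g : (∀ j, α j) → ℝ := fun x => ∫ a, f (Function.update x i a) ∂μ i
    have hmp := measurePreserving_update_infinitePi (μ := μ) i
    have hfu : Measurable fun p : (∀ j, α j) × α i => f (Function.update p.1 i p.2) :=
      hf.comp hmp.measurable
    have hg : Measurable g := hfu.stronglyMeasurable.integral_prod_right'.measurable
    have integral_g : ∫ x, g x ∂Measure.infinitePi μ = ∫ x, f x ∂Measure.infinitePi μ := by
      conv_rhs =>
        rw [← hmp.map_eq, integral_map hmp.measurable.aemeasurable hf.aestronglyMeasurable]
      exact (integral_prod _ (hmp.integrable_comp_of_integrable (h.integrable hf _))).symm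
    have hinner (x : ∀ j, α j) :
        HasSubgaussianMGF (fun a => f (Function.update x i a) - g x) ((c i / 2) ^ 2) (μ i) :=
      hasSubgaussianMGF_sub_integral_of_le_add
        (hf.comp (measurable_update x)).aemeasurable (h.update_le x)
    have hprod := hasSubgaussianMGF_add_prod (ih (h.integral_update (μ := μ) hi hf) hg) hinner
      (hfu.sub (hg.comp measurable_fst)).aemeasurable
    have hF : Measurable fun x => f x - ∫ y, f y ∂Measure.infinitePi μ := hf.sub_const _
    rw [Finset.sum_insert hi, add_comm]
    refine hprod.congr_identDistrib ⟨?_, hF.aemeasurable, ?_⟩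
    · simpa only [g, integral_g, sub_add_sub_cancel'] using (hfu.sub_const _).aemeasurable
    · have hmap := Measure.map_map hF hmp.measurable (μ := (Measure.infinitePi μ).prod (μ i))
      rw [hmp.map_eq] at hmap
      simpa only [g, integral_g, sub_add_sub_cancel', Function.comp_def] using hmap.symm

lemma HasBoundedDifferences.measureReal_le_abs_sub_integral_le (h : HasBoundedDifferences f s c)
    (hf : Measurable f) {ε : ℝ} (hε : 0 ≤ ε) :
    (Measure.infinitePi μ).real {x | ε ≤ |f x - ∫ y, f y ∂Measure.infinitePi μ|} ≤
      2 * Real.exp (-ε ^ 2 / (2 * ∑ i ∈ s, ((c i : ℝ) / 2) ^ 2)) := by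
  have hsub := h.hasSubgaussianMGF (μ := μ) hf
  have hupper := hsub.measure_ge_le hε
  have hlower := hsub.neg.measure_ge_le hε
  push_cast at hupper hlower
  rw [two_mul (Real.exp _)]
  refine le_trans ?_ ((measureReal_union_le _ _).trans (add_le_add hupper hlower))
  refine measureReal_mono fun x hx => ?_
  simpa only [Set.mem_union, Set.mem_ofPred_eq, Pi.neg_apply, le_abs] using hx

lemma HasBoundedDifferences.measurable [∀ i, Finite (α i)] [∀ i, MeasurableSingletonClass (α i)]
    (h : HasBoundedDifferences f s c) : Measurable f := by
  obtain ⟨g, rfl⟩ := dependsOn_iff_exists_comp.1 h.dependsOn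
  exact (Measurable.of_discrete (f := g)).comp (Finset.measurable_restrict s)

end BoundedDifferences

section ExponentialDecay

open Filter Asymptotics Topology

/-- Exponential decay at some rate that is not specified, so that the notion is stable under finite
sums and linear changes of the index. -/
def IsExpSmall (p : ℕ → ℝ) : Prop :=
  ∃ θ : ℝ, 0 < θ ∧ p =O[atTop] fun n : ℕ => Real.exp (-θ * n)

variable {p q : ℕ → ℝ}

lemma IsExpSmall.mono (hq : IsExpSmall q) (h : ∀ᶠ n in atTop, |p n| ≤ q n) : IsExpSmall p := by
  obtain ⟨θ, hθ, hO⟩ := hq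
  refine ⟨θ, hθ, (IsBigO.of_bound' ?_).trans hO⟩
  filter_upwards [h] with n hn using hn.trans (le_abs_self _)

lemma IsExpSmall.add (hp : IsExpSmall p) (hq : IsExpSmall q) : IsExpSmall fun n => p n + q n := by
  obtain ⟨θ, hθ, hp⟩ := hp
  obtain ⟨θ', hθ', hq⟩ := hq
  have weaken {a b : ℝ} (hab : a ≤ b) :
      (fun n : ℕ => Real.exp (-b * n)) =O[atTop] fun n : ℕ => Real.exp (-a * n) := by
    refine IsBigO.of_bound' (.of_forall fun n => ?_)
    simp only [Real.norm_eq_abs, Real.abs_exp]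
    gcongr
  exact ⟨min θ θ', lt_min hθ hθ', (hp.trans (weaken (min_le_left _ _))).add
    (hq.trans (weaken (min_le_right _ _)))⟩

lemma IsExpSmall.sum {ι : Type*} {s : Finset ι} {p : ι → ℕ → ℝ} (h : ∀ i ∈ s, IsExpSmall (p i)) :
    IsExpSmall fun n => ∑ i ∈ s, p i n := by
  classical
  induction s using Finset.induction_on with
  | empty => exact ⟨1, one_pos, by simpa using isBigO_zero _ _⟩
  | insert i s hi ih =>
    simp only [Finset.sum_insert hi]
    exact (h i (s.mem_insert_self i)).add (ih fun j hj => h j (Finset.mem_insert_of_mem hj))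

lemma IsExpSmall.measureReal_mono {Ω : Type*} [MeasurableSpace Ω] {μ : Measure Ω}
    [IsFiniteMeasure μ] {s t : ℕ → Set Ω} (ht : IsExpSmall fun n => μ.real (t n))
    (h : ∀ᶠ n in atTop, s n ⊆ t n) : IsExpSmall fun n => μ.real (s n) :=
  ht.mono (h.mono fun n hn => by
    rw [abs_of_nonneg measureReal_nonneg]
    exact MeasureTheory.measureReal_mono hn)

lemma IsExpSmall.measureReal_union {Ω : Type*} [MeasurableSpace Ω] {μ : Measure Ω}
    [IsFiniteMeasure μ] {s t : ℕ → Set Ω} (hs : IsExpSmall fun n => μ.real (s n))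
    (ht : IsExpSmall fun n => μ.real (t n)) : IsExpSmall fun n => μ.real (s n ∪ t n) :=
  (hs.add ht).mono (.of_forall fun n => by
    rw [abs_of_nonneg measureReal_nonneg]
    exact measureReal_union_le _ _)

lemma IsExpSmall.measureReal_iUnion {Ω ι : Type*} [MeasurableSpace Ω] {μ : Measure Ω}
    [IsFiniteMeasure μ] [Finite ι] {s : ι → ℕ → Set Ω}
    (hs : ∀ i, IsExpSmall fun n => μ.real (s i n)) : IsExpSmall fun n => μ.real (⋃ i, s i n) := by
  have := Fintype.ofFinite ι
  refine (IsExpSmall.sum (s := .univ) fun i _ => hs i).mono (.of_forall fun n => ?_)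
  rw [abs_of_nonneg measureReal_nonneg]
  exact measureReal_iUnion_fintype_le _

lemma IsExpSmall.comp_div (hp : IsExpSmall p) {d : ℕ} (hd : 0 < d) :
    IsExpSmall fun n => p (n / d) := by
  obtain ⟨θ, hθ, hp⟩ := hp
  have hd' : (0 : ℝ) < d := Nat.cast_pos.2 hd
  refine ⟨θ / d, div_pos hθ hd', (hp.comp_tendsto (Nat.tendsto_div_const_atTop hd.ne')).trans
    (IsBigO.of_bound (Real.exp θ) (.of_forall fun n => ?_))⟩
  have hn : (n : ℝ) / d ≤ (n / d : ℕ) + 1 := by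
    rw [← Nat.floor_div_eq_div (K := ℝ)]; exact (Nat.lt_floor_add_one _).le
  simp only [Function.comp_apply, Real.norm_eq_abs, Real.abs_exp, ← Real.exp_add]
  gcongr
  calc -θ * (n / d : ℕ) = θ - θ * ((n / d : ℕ) + 1) := by ring
    _ ≤ θ - θ * (n / d) := by gcongr
    _ = θ + -(θ / d) * n := by ring

lemma IsExpSmall.exists_eventually_le_exp (hp : IsExpSmall p) :
    ∃ θ : ℝ, 0 < θ ∧ ∀ᶠ n : ℕ in atTop, p n ≤ Real.exp (-θ * n) := by
  obtain ⟨θ, hθ, hp⟩ := hp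
  refine ⟨θ / 2, half_pos hθ, ?_⟩
  have hlittle :
      (fun n : ℕ => Real.exp (-θ * n)) =o[atTop] fun n : ℕ => Real.exp (-(θ / 2) * n) := by
    rw [Real.isLittleO_exp_comp_exp_comp]
    have := tendsto_natCast_atTop_atTop (R := ℝ) |>.const_mul_atTop (half_pos hθ)
    refine this.congr fun n => ?_
    ring
  filter_upwards [(hp.trans_isLittleO hlittle).bound one_pos] with n hn
  simpa using (le_abs_self _).trans hn

lemma IsExpSmall.tendsto_zero (hp : IsExpSmall p) : Tendsto p atTop (𝓝 0) := by
  obtain ⟨θ, hθ, hp⟩ := hp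
  refine hp.trans_tendsto ?_
  refine Real.tendsto_exp_atBot.comp ?_
  exact tendsto_natCast_atTop_atTop.const_mul_atTop_of_neg (neg_neg_of_pos hθ)

end ExponentialDecay

lemma isExpSmall_measureReal_le_abs_sub_integral {ι : Type*} {α : ι → Type*}
    [∀ i, MeasurableSpace (α i)] {μ : ∀ i, Measure (α i)} [∀ i, IsProbabilityMeasure (μ i)]
    {f : ℕ → (∀ i, α i) → ℝ} {s : ℕ → Finset ι} {c : ℝ≥0} {C : ℕ}
    (h : ∀ k, HasBoundedDifferences (f k) (s k) fun _ => c) (hf : ∀ k, Measurable (f k))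
    (hs : ∀ k, (s k).card = C * k) (hc : 0 < c) (hC : 0 < C) {ε : ℝ} (hε : 0 < ε) :
    IsExpSmall fun k => (Measure.infinitePi μ).real
      {x | ε * k ≤ |f k x - ∫ y, f k y ∂Measure.infinitePi μ|} := by
  have hexponent (k : ℕ) : -(ε * k) ^ 2 / (2 * ∑ i ∈ s k, ((c : ℝ) / 2) ^ 2) =
      -(2 * ε ^ 2 / (C * c ^ 2)) * k := by
    rw [Finset.sum_const, hs, nsmul_eq_mul]
    rcases k.eq_zero_or_pos with rfl | hk
    · simp
    · push_cast
      field_simp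
  refine ⟨2 * ε ^ 2 / (C * c ^ 2), by positivity, .of_bound 2 (.of_forall fun k => ?_)⟩
  rw [Real.norm_of_nonneg measureReal_nonneg, Real.norm_of_nonneg (Real.exp_nonneg _), ← hexponent]
  exact (h k).measureReal_le_abs_sub_integral_le (hf k) (by positivity)

section SumOfCoordinates

variable {ι : Type*} {α : ι → Type*} {g : ∀ i, α i → ℝ}

lemma HasBoundedDifferences.of_le_add_sum {f : (∀ i, α i) → ℝ} {s : Finset ι} {c : ι → ℝ≥0}
    {d : ∀ i, α i → α i → ℝ} (hf : ∀ x y, f x ≤ f y + ∑ i ∈ s, d i (x i) (y i))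
    (hd : ∀ i ∈ s, ∀ a b, d i a b ≤ c i) (hself : ∀ i a, d i a a = 0) :
    HasBoundedDifferences f s c := by
  classical
  intro x y
  rw [Finset.sum_filter]
  refine (hf x y).trans (add_le_add_right (Finset.sum_le_sum fun i hi => ?_) _)
  split_ifs with hxy
  · exact hd i hi _ _
  · rw [not_not.1 hxy, hself]

lemma hasBoundedDifferences_sum {s : Finset ι} {c : ι → ℝ≥0}
    (h : ∀ i ∈ s, ∀ a b, g i a ≤ g i b + c i) :
    HasBoundedDifferences (fun x => ∑ i ∈ s, g i (x i)) s c :=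
  .of_le_add_sum (d := fun i a b => g i a - g i b)
    (fun x y => by rw [← Finset.sum_add_distrib]; simp)
    (fun i hi a b => sub_le_iff_le_add'.2 (h i hi a b)) fun i a => sub_self _

variable [∀ i, MeasurableSpace (α i)] {μ : ∀ i, Measure (α i)} [∀ i, IsProbabilityMeasure (μ i)]

lemma integral_sum_infinitePi {s : Finset ι} (hg : ∀ i ∈ s, Integrable (g i) (μ i)) :
    ∫ x, ∑ i ∈ s, g i (x i) ∂Measure.infinitePi μ = ∑ i ∈ s, ∫ a, g i a ∂μ i := by
  have heval (i : ι) := measurePreserving_eval_infinitePi μ i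
  have hint (i : ι) (hi : i ∈ s) :
      Integrable (fun x : ∀ i, α i => g i (x i)) (Measure.infinitePi μ) :=
    (heval i).integrable_comp_of_integrable (hg i hi)
  rw [integral_finsetSum s hint]
  refine Finset.sum_congr rfl fun i hi => ?_
  have hm := (hg i hi).aestronglyMeasurable
  rw [← (heval i).map_eq] at hm
  conv_rhs => rw [← (heval i).map_eq]
  exact (integral_map (heval i).measurable.aemeasurable hm).symm

end SumOfCoordinates

/-! ### Random block lengths -/

section Marks

open Filter Topology

/-- The block lengths encoded by marks `t i ∈ {0, 1, 2}`; uniform marks make them uniform on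
`{l - 1, l, l + 1}`. -/
def blockLengths (l : ℕ) (t : ℕ → Fin 3) (i : ℕ) : ℕ :=
  l - 1 + t i

/-- The law of two independent sequences of independent uniform marks. The coordinates `.inl i`
encode the block lengths of the first word, the coordinates `.inr i` those of the second word. -/
noncomputable abbrev markLaw : Measure (ℕ ⊕ ℕ → Fin 3) :=
  Measure.infinitePi fun _ => (PMF.uniformOfFintype (Fin 3)).toMeasure

lemma integral_uniform_fin_three (g : Fin 3 → ℝ) :
    ∫ t, g t ∂(PMF.uniformOfFintype (Fin 3)).toMeasure = (g 0 + g 1 + g 2) / 3 := by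
  rw [PMF.integral_eq_sum]
  simp [Fin.sum_univ_three]
  ring

lemma integral_sum_marks (e : ℕ ↪ ℕ ⊕ ℕ) (g : Fin 3 → ℝ) (N : ℕ) :
    ∫ ξ, ∑ i ∈ Finset.range N, g (ξ (e i)) ∂markLaw = N * ((g 0 + g 1 + g 2) / 3) := by
  have h := integral_sum_infinitePi (s := (Finset.range N).map e) (g := fun _ => g)
    (μ := fun _ => (PMF.uniformOfFintype (Fin 3)).toMeasure) fun _ _ => .of_finite
  simpa [integral_uniform_fin_three] using h

lemma isExpSmall_abs_sum_marks_sub (e : ℕ ↪ ℕ ⊕ ℕ) {g : Fin 3 → ℝ} (hg : ∀ a b, g a ≤ g b + 2)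
    {C : ℕ} (hC : 0 < C) {ε : ℝ} (hε : 0 < ε) :
    IsExpSmall fun k => markLaw.real {ξ | ε * k ≤
      |∑ i ∈ Finset.range (C * k), g (ξ (e i)) - C * k * ((g 0 + g 1 + g 2) / 3)|} := by
  have hbdd (k : ℕ) : HasBoundedDifferences (α := fun _ => Fin 3)
      (fun ξ => ∑ i ∈ Finset.range (C * k), g (ξ (e i))) ((Finset.range (C * k)).map e)
      fun _ => 2 := by
    simpa only [Finset.sum_map] using
      hasBoundedDifferences_sum (s := (Finset.range (C * k)).map e) (c := fun _ => 2)
        (α := fun _ => Fin 3) (g := fun _ => g) fun _ _ => hg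
  have h := isExpSmall_measureReal_le_abs_sub_integral
    (μ := fun _ => (PMF.uniformOfFintype (Fin 3)).toMeasure) hbdd (fun k => (hbdd k).measurable)
    (fun k => by simp) two_pos hC hε
  simpa only [integral_sum_marks, Nat.cast_mul] using h

/-- The length of a longest common subsequence of the first `M` blocks of the first word, which
starts with the letter `c`, and the first `N` blocks of the second word, which starts with `c'`. -/
noncomputable def blockLcs (l : ℕ) (c c' : Bool) (M N : ℕ) (ξ : ℕ ⊕ ℕ → Fin 3) : ℝ :=
  lcs (firstBlocks c (blockLengths l (ξ ∘ Sum.inl)) M)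
    (firstBlocks c' (blockLengths l (ξ ∘ Sum.inr)) N)

lemma hasBoundedDifferences_blockLcs (l : ℕ) (c c' : Bool) (M N : ℕ) :
    HasBoundedDifferences (blockLcs l c c' M N)
      ((Finset.range M).disjSum (Finset.range N)) fun _ => 2 := by
  refine .of_le_add_sum (d := fun _ a b => ((l - 1 + a - (l - 1 + b) : ℕ) : ℝ)) (fun ξ ζ => ?_)
    (fun _ _ a b => ?_) fun _ a => by simp
  · have hX := lcs_firstBlocks_le_add c (blockLengths l (ξ ∘ Sum.inl))
      (blockLengths l (ζ ∘ Sum.inl)) M (firstBlocks c' (blockLengths l (ξ ∘ Sum.inr)) N)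
    have hY := lcs_firstBlocks_le_add c' (blockLengths l (ξ ∘ Sum.inr))
      (blockLengths l (ζ ∘ Sum.inr)) N (firstBlocks c (blockLengths l (ζ ∘ Sum.inl)) M)
    rw [lcs_comm, lcs_comm (firstBlocks c' _ N)] at hY
    have hXY := hX.trans (add_le_add_left hY _)
    rw [add_assoc, add_comm (∑ i ∈ Finset.range N, _)] at hXY
    rw [Finset.sum_disjSum]
    unfold blockLcs
    exact_mod_cast hXY
  · have hab : l - 1 + (a : ℕ) - (l - 1 + b) ≤ 2 := by omega
    rw [NNReal.coe_ofNat]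
    exact_mod_cast hab

lemma integrable_blockLcs (l : ℕ) (c c' : Bool) (M N : ℕ) :
    Integrable (blockLcs l c c' M N) markLaw :=
  have h := hasBoundedDifferences_blockLcs l c c' M N
  h.integrable h.measurable _

/-- The mean length of a longest common subsequence of `M` blocks of the first and `N` blocks of the
second word, for given first letters. -/
noncomputable def meanLcs (l : ℕ) (c c' : Bool) (M N : ℕ) : ℝ :=
  ∫ ξ, blockLcs l c c' M N ξ ∂markLaw

lemma isExpSmall_abs_blockLcs_sub_meanLcs (l : ℕ) (c c' : Bool) {C C' : ℕ} (hC : 0 < C) {ε : ℝ}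
    (hε : 0 < ε) :
    IsExpSmall fun k => markLaw.real
      {ξ | ε * k ≤ |blockLcs l c c' (C * k) (C' * k) ξ - meanLcs l c c' (C * k) (C' * k)|} :=
  isExpSmall_measureReal_le_abs_sub_integral
    (fun k => hasBoundedDifferences_blockLcs l c c' (C * k) (C' * k))
    (fun k => (hasBoundedDifferences_blockLcs l c c' (C * k) (C' * k)).measurable)
    (C := C + C') (fun k => by simp [add_mul]) two_pos (Nat.add_pos_left hC C') hε

lemma mean_blockLengths {l : ℕ} (hl : 0 < l) :
    (((l - 1 + (0 : Fin 3) : ℕ) : ℝ) + (l - 1 + (1 : Fin 3) : ℕ) + (l - 1 + (2 : Fin 3) : ℕ)) / 3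
      = l := by
  push_cast [Nat.cast_sub hl]
  norm_num
  ring

lemma integral_sum_blockLengths {l : ℕ} (hl : 0 < l) (e : ℕ ↪ ℕ ⊕ ℕ) (N : ℕ) :
    ∫ ξ, ((∑ i ∈ Finset.range N, blockLengths l (ξ ∘ e) i : ℕ) : ℝ) ∂markLaw = N * l := by
  push_cast
  exact (integral_sum_marks e (fun t => ((l - 1 + t : ℕ) : ℝ)) N).trans
    (by rw [mean_blockLengths hl])

lemma integrable_sum_blockLengths (l : ℕ) (e : ℕ ↪ ℕ ⊕ ℕ) (N : ℕ) :
    Integrable (fun ξ => ((∑ i ∈ Finset.range N, blockLengths l (ξ ∘ e) i : ℕ) : ℝ)) markLaw := by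
  push_cast
  refine integrable_finsetSum _ fun i _ => ?_
  exact (measurePreserving_eval_infinitePi _ (e i)).integrable_comp_of_integrable
    (g := fun t : Fin 3 => ((l - 1 + t : ℕ) : ℝ)) .of_finite

lemma isExpSmall_abs_sum_blockLengths_sub {l : ℕ} (hl : 0 < l) (e : ℕ ↪ ℕ ⊕ ℕ) {C : ℕ} (hC : 0 < C)
    {ε : ℝ} (hε : 0 < ε) :
    IsExpSmall fun k => markLaw.real {ξ | ε * k ≤
      |((∑ i ∈ Finset.range (C * k), blockLengths l (ξ ∘ e) i : ℕ) : ℝ) - C * k * l|} := by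
  have hbdd (a b : Fin 3) : ((l - 1 + a : ℕ) : ℝ) ≤ (l - 1 + b : ℕ) + 2 := by
    exact_mod_cast (by omega)
  have h := isExpSmall_abs_sum_marks_sub e hbdd hC hε
  rw [mean_blockLengths hl] at h
  simpa only [blockLengths, Nat.cast_sum, Function.comp_apply] using h

lemma measurable_excess (l N : ℕ) :
    Measurable fun ξ : ℕ ⊕ ℕ → Fin 3 => (excess (blockLengths l (ξ ∘ Sum.inl)) N : ℝ) := by
  refine (Measurable.of_discrete (f := fun m : ℤ => (m : ℝ))).comp
    (Finset.measurable_fun_sum _ fun i _ => ?_)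
  exact (Measurable.of_discrete
    (f := fun t : Fin 3 => if l - 1 + (t : ℕ) = 0 then (-1 : ℤ) else 1)).comp
    (measurable_pi_apply (Sum.inl i))

lemma isExpSmall_excess_le (l : ℕ) {C : ℕ} (hC : 0 < C) {ε : ℝ} (hε : 0 < ε) :
    IsExpSmall fun k => markLaw.real
      {ξ | (excess (blockLengths l (ξ ∘ Sum.inl)) (C * k) : ℝ) ≤ C * k / 3 - ε * k} := by
  set g : Fin 3 → ℝ := fun t => if l - 1 + (t : ℕ) = 0 then -1 else 1 with hg
  have hbdd (a b : Fin 3) : g a ≤ g b + 2 := by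
    simp only [hg]
    split_ifs <;> norm_num
  have hmean : 1 / 3 ≤ (g 0 + g 1 + g 2) / 3 := by
    have h1 : g 1 = 1 := if_neg (by simp)
    have h2 : g 2 = 1 := if_neg (by simp)
    have h0 : -1 ≤ g 0 := by
      simp only [hg]
      split_ifs <;> norm_num
    linarith
  have hexcess (t : ℕ → Fin 3) (N : ℕ) :
      (excess (blockLengths l t) N : ℝ) = ∑ i ∈ Finset.range N, g (t i) := by
    simp [excess, blockLengths, hg]
  refine (isExpSmall_abs_sum_marks_sub .inl hbdd hC hε).measureReal_mono
    (.of_forall fun k ξ hξ => ?_)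
  simp only [Set.mem_ofPred_eq, hexcess, Function.comp_apply] at hξ
  have hCk : (C * k : ℝ) * (1 / 3) ≤ C * k * ((g 0 + g 1 + g 2) / 3) := by gcongr
  refine le_trans ?_ (neg_le_abs (_ : ℝ))
  simp only [Function.Embedding.inl_apply]
  linarith

/-! ### Mean longest common subsequences -/

lemma meanLcs_le {l : ℕ} (hl : 0 < l) (c c' : Bool) (M N : ℕ) : meanLcs l c c' M N ≤ M * l := by
  rw [← integral_sum_blockLengths hl .inl M]
  refine integral_mono_of_nonneg (.of_forall fun ξ => Nat.cast_nonneg _) ?_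
    (.of_forall fun ξ => Nat.cast_le.2 ?_)
  · exact integrable_sum_blockLengths l .inl M
  · exact (lcs_le_length_left _ _).trans_eq (length_firstBlocks _ _ _)

lemma measurePreserving_comp_markLaw {e : ℕ ⊕ ℕ → ℕ ⊕ ℕ} (he : e.Injective) :
    MeasurePreserving (fun ξ : ℕ ⊕ ℕ → Fin 3 => ξ ∘ e) markLaw markLaw :=
  ⟨by fun_prop, Measure.map_infinitePi_infinitePi_of_inj he⟩

lemma meanLcs_add_le (l : ℕ) (c c' : Bool) {M N : ℕ} (hM : Even M) (hN : Even N) (M' N' : ℕ) :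
    meanLcs l c c' M N + meanLcs l c c' M' N' ≤ meanLcs l c c' (M + M') (N + N') := by
  have hshift := measurePreserving_comp_markLaw
    ((add_right_injective M).sumMap (add_right_injective N))
  have hint : Integrable (fun ξ => blockLcs l c c' M' N' (ξ ∘ Sum.map (M + ·) (N + ·))) markLaw :=
    hshift.integrable_comp_of_integrable (integrable_blockLcs l c c' M' N')
  have hmean : ∫ ξ, blockLcs l c c' M' N' (ξ ∘ Sum.map (M + ·) (N + ·)) ∂markLaw =
      meanLcs l c c' M' N' := by
    have hm := (integrable_blockLcs l c c' M' N').aestronglyMeasurable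
    rw [← hshift.map_eq] at hm
    rw [meanLcs, ← integral_map hshift.measurable.aemeasurable hm, hshift.map_eq]
  rw [← hmean, meanLcs, ← integral_add (integrable_blockLcs l c c' M N) hint]
  refine integral_mono ((integrable_blockLcs l c c' M N).add hint)
    (integrable_blockLcs l c c' _ _) fun ξ => ?_
  unfold blockLcs
  rw [firstBlocks_add c _ hM, firstBlocks_add c' _ hN]
  exact_mod_cast lcs_add_lcs_le_lcs_append _ _ _ _

lemma sum_blockLengths_le {l : ℕ} (hl : 0 < l) (t : ℕ → Fin 3) (N : ℕ) :
    ∑ i ∈ Finset.range N, blockLengths l t i ≤ (l + 1) * N := by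
  rw [mul_comm]
  simpa using Finset.sum_le_card_nsmul (Finset.range N) (blockLengths l t) (l + 1)
    fun i _ => by unfold blockLengths; omega

-- `9 (l + 1) N` blocks typically contain an alternating subsequence of length at least
-- `2 (l + 1) N`, which is long enough to embed all of the other word.
lemma sum_blockLengths_le_blockLcs_of_lt_excess {l : ℕ} (hl : 0 < l) (c c' : Bool) {N : ℕ}
    {ξ : ℕ ⊕ ℕ → Fin 3} (hξ : ((9 * (l + 1) : ℕ) : ℝ) * N / 3 - 1 * N <
      excess (blockLengths l (ξ ∘ Sum.inl)) (9 * (l + 1) * N)) :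
    ((∑ i ∈ Finset.range N, blockLengths l (ξ ∘ Sum.inr) i : ℕ) : ℝ) ≤
      blockLcs l c c' (9 * (l + 1) * N) N ξ := by
  refine Nat.cast_le.2 (sum_le_lcs_firstBlocks_of_le_excess c c' ?_)
  have hsum := sum_blockLengths_le hl (ξ ∘ Sum.inr) N
  rify at hsum ⊢
  push_cast at hξ hsum ⊢
  nlinarith [Nat.cast_nonneg (α := ℝ) N]

lemma eventually_le_meanLcs {l : ℕ} (hl : 0 < l) (c c' : Bool) {ε : ℝ} (hε : 0 < ε) :
    ∀ᶠ N : ℕ in atTop, (l - ε) * N ≤ meanLcs l c c' (9 * (l + 1) * N) N := by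
  set C := 9 * (l + 1)
  set bad : ℕ → Set (ℕ ⊕ ℕ → Fin 3) := fun N =>
    {ξ | (excess (blockLengths l (ξ ∘ Sum.inl)) (C * N) : ℝ) ≤ C * N / 3 - 1 * N}
  have hbad_zero : Tendsto (fun N => (l + 1) * markLaw.real (bad N)) atTop (𝓝 0) := by
    rw [← mul_zero (l + 1 : ℝ)]
    exact (isExpSmall_excess_le l (by positivity) one_pos).tendsto_zero.const_mul _
  have hpointwise (N : ℕ) (ξ : ℕ ⊕ ℕ → Fin 3) :
      ((∑ i ∈ Finset.range N, blockLengths l (ξ ∘ .inr) i : ℕ) : ℝ) ≤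
        blockLcs l c c' (C * N) N ξ + (bad N).indicator (fun _ => (l + 1) * (N : ℝ)) ξ := by
    by_cases hξ : ξ ∈ bad N
    · rw [Set.indicator_of_mem hξ]
      exact le_add_of_nonneg_of_le (Nat.cast_nonneg _) (mod_cast sum_blockLengths_le hl _ N)
    · rw [Set.indicator_of_notMem hξ, add_zero]
      exact sum_blockLengths_le_blockLcs_of_lt_excess hl c c' (not_le.1 hξ)
  filter_upwards [hbad_zero.eventually_le_const hε] with N hN
  have hmeas : MeasurableSet (bad N) := measurableSet_le (measurable_excess l _) measurable_const
  have hint : Integrable ((bad N).indicator fun _ => (l + 1) * (N : ℝ)) markLaw :=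
    (integrable_const _).indicator hmeas
  have hmean : N * l ≤ meanLcs l c c' (C * N) N + markLaw.real (bad N) * ((l + 1) * N) :=
    calc (N * l : ℝ)
        = ∫ ξ, ((∑ i ∈ Finset.range N, blockLengths l (ξ ∘ .inr) i : ℕ) : ℝ) ∂markLaw :=
          (integral_sum_blockLengths hl .inr N).symm
      _ ≤ _ := integral_mono (integrable_sum_blockLengths l .inr N)
          ((integrable_blockLcs l c c' (C * N) N).add hint) (hpointwise N)
      _ = _ := by
          rw [integral_add' (integrable_blockLcs l c c' (C * N) N) hint,
            integral_indicator_const _ hmeas, smul_eq_mul, meanLcs]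
  have hNε := mul_le_mul_of_nonneg_right hN N.cast_nonneg
  linarith

/-! ### The gap -/

lemma exists_tendsto_meanLcs_div {l : ℕ} (hl : 0 < l) (c c' : Bool) (a : ℕ) :
    ∃ g : ℝ, Tendsto (fun k : ℕ => meanLcs l c c' (2 * a * k) (2 * a * k) / k) atTop (𝓝 g) ∧
      ∀ k : ℕ, meanLcs l c c' (2 * a * k) (2 * a * k) ≤ g * k := by
  have hsub : Subadditive fun k : ℕ => -meanLcs l c c' (2 * a * k) (2 * a * k) := by
    intro k m
    have h := meanLcs_add_le l c c' (M := 2 * a * k) (N := 2 * a * k) (by simp [mul_assoc])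
      (by simp [mul_assoc]) (2 * a * m) (2 * a * m)
    rw [← mul_add] at h
    linarith
  have hbdd : BddBelow (Set.range fun k : ℕ => -meanLcs l c c' (2 * a * k) (2 * a * k) / k) := by
    refine ⟨-(2 * a * l), ?_⟩
    rintro _ ⟨k, rfl⟩
    rcases k.eq_zero_or_pos with rfl | hk
    · simp only [Nat.cast_zero, div_zero, Left.neg_nonpos_iff]
      positivity
    · have := meanLcs_le hl c c' (2 * a * k) (2 * a * k)
      push_cast at this
      rw [le_div_iff₀ (Nat.cast_pos.2 hk)]
      linarith
  refine ⟨-hsub.lim, ?_, fun k => ?_⟩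
  · simpa [neg_div] using (hsub.tendsto_lim hbdd).neg
  · rcases k.eq_zero_or_pos with rfl | hk
    · simpa using meanLcs_le hl c c' 0 0
    · have h := hsub.lim_le_div hbdd hk.ne'
      rw [le_div_iff₀ (Nat.cast_pos.2 hk)] at h
      linarith

lemma mul_meanLcs_add_le (l : ℕ) (c c' : Bool) {M N : ℕ} (hM : Even M) (hN : Even N)
    (M' N' q : ℕ) :
    q * meanLcs l c c' M N + meanLcs l c c' M' N' ≤ meanLcs l c c' (q * M + M') (q * N + N') := by
  induction q with
  | zero => simp
  | succ q ih =>
    have h := meanLcs_add_le l c c' hM hN (q * M + M') (q * N + N')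
    rw [show (q + 1) * M + M' = M + (q * M + M') by ring,
      show (q + 1) * N + N' = N + (q * N + N') by ring]
    push_cast
    linarith

-- The block counts balance: `D (a + 1) a + (D + 1) (a + 1) = (D (a + 1) + 1) (a + 1)`.
lemma mul_meanLcs_add_meanLcs_le_balanced (l : ℕ) (c c' : Bool) (a D k : ℕ) :
    (D * (a + 1) : ℕ) * meanLcs l c c' (2 * a * k) (2 * (a + 1) * k) +
        meanLcs l c c' ((D + 1) * (2 * (a + 1) * k)) (2 * (a + 1) * k) ≤
      meanLcs l c c' (2 * (a + 1) * ((D * (a + 1) + 1) * k))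
        (2 * (a + 1) * ((D * (a + 1) + 1) * k)) := by
  have h := mul_meanLcs_add_le l c c' (M := 2 * a * k) (N := 2 * (a + 1) * k)
    (by simp [mul_assoc]) (by simp [mul_assoc]) ((D + 1) * (2 * (a + 1) * k)) (2 * (a + 1) * k)
    (D * (a + 1))
  convert h using 2 <;> ring

-- Trading `q` pairs of words with `a : a + 1` blocks and one unbalanced pair for `q + 1` balanced
-- pairs gains a positive amount, as the unbalanced pair already has the largest possible common
-- subsequence.
lemma exists_pos_eventually_meanLcs_add_le {l : ℕ} (hl : 0 < l) (c c' : Bool) (a : ℕ) :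
    ∃ γ : ℝ, 0 < γ ∧ ∀ᶠ k : ℕ in atTop,
      meanLcs l c c' (2 * a * k) (2 * (a + 1) * k) + γ * k ≤
        meanLcs l c c' (2 * (a + 1) * k) (2 * (a + 1) * k) := by
  obtain ⟨g, hg, hle⟩ := exists_tendsto_meanLcs_div hl c c' (a + 1)
  set q := (9 * l + 8) * (a + 1)
  have : (0 : ℝ) < l := Nat.cast_pos.2 hl
  set γ : ℝ := l / (2 * (q + 1)) with hγ
  have hγ_pos : 0 < γ := by positivity
  have hγ_mul : 2 * (q + 1) * γ = l := by rw [hγ]; field_simp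
  refine ⟨γ, hγ_pos, ?_⟩
  have htop : Tendsto (fun k : ℕ => 2 * (a + 1) * k) atTop atTop :=
    tendsto_id.const_mul_atTop' (by positivity)
  filter_upwards [htop.eventually
    (eventually_le_meanLcs hl c c' (ε := l / (2 * (a + 1))) (by positivity)),
    hg.eventually_const_le (sub_lt_self g hγ_pos), eventually_gt_atTop 0] with k hunbal hbal hk
  set u := meanLcs l c c' (2 * a * k) (2 * (a + 1) * k)
  rw [le_div_iff₀ (Nat.cast_pos.2 hk)] at hbal
  have hcombine : q * u + meanLcs l c c' (9 * (l + 1) * (2 * (a + 1) * k)) (2 * (a + 1) * k) ≤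
      g * ((q + 1) * k : ℕ) :=
    (mul_meanLcs_add_meanLcs_le_balanced l c c' a (9 * l + 8) k).trans (hle _)
  have hu_le : u ≤ 2 * a * k * l := by
    simpa using meanLcs_le hl c c' (2 * a * k) (2 * (a + 1) * k)
  have hunbal' : 2 * (a + 1) * k * l - l * k ≤
      meanLcs l c c' (9 * (l + 1) * (2 * (a + 1) * k)) (2 * (a + 1) * k) := by
    refine le_trans (le_of_eq ?_) hunbal
    push_cast
    field_simp
  have hgain : (q + 1 : ℝ) * u + l * k ≤ (q + 1) * (g * k) := by
    push_cast at hcombine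
    linarith
  have hgap : u + 2 * γ * k ≤ g * k := by
    refine le_of_mul_le_mul_left ?_ (by positivity : (0 : ℝ) < q + 1)
    linarith [congrArg (· * (k : ℝ)) hγ_mul]
  linarith

/-! ### Typical words -/

-- The words have about `2 l k` letters beyond their first `2 a k` blocks. By `ha`, this is at most
-- the proportion `δ` of the number of maximal runs, which is typically at least about `2 a k / 3`.
lemma not_manyLeftOutAtEnd_of_typical {l : ℕ} (hl : 0 < l) {c c' : Bool} {X Y : ℕ → ℕ} {a k n : ℕ}
    {δ γ η m m' : ℝ} (hδ : 0 ≤ δ) (ha : 2 * l ≤ δ * (2 * a / 3 - 1)) (hη : 0 < η) (hη1 : η ≤ 1)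
    (hηγ : 11 * η ≤ γ) (hk : 0 < k) (hkn : 2 * (a + 1) * l * k ≤ n)
    (hnk : (n : ℝ) ≤ 2 * (a + 1) * l * k + η * k) (hm : m + γ * k ≤ m')
    (hA : |((∑ i ∈ Finset.range (2 * a * k), X i : ℕ) : ℝ) - 2 * a * k * l| < η * k)
    (hX : |((∑ i ∈ Finset.range (2 * (a + 1) * k), X i : ℕ) : ℝ) - 2 * (a + 1) * k * l| < η * k)
    (hY : |((∑ i ∈ Finset.range (2 * (a + 1) * k), Y i : ℕ) : ℝ) - 2 * (a + 1) * k * l| < η * k)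
    (hexcess : 2 * a * k / 3 - η * k < excess X (2 * a * k))
    (hL : |(lcs (firstBlocks c X (2 * a * k)) (firstBlocks c' Y (2 * (a + 1) * k)) : ℝ) - m| <
      η * k)
    (hL' : |(lcs (firstBlocks c X (2 * (a + 1) * k)) (firstBlocks c' Y (2 * (a + 1) * k)) : ℝ) -
      m'| < η * k) :
    ¬ ManyLeftOutAtEnd δ (blockWord c X n) (blockWord c' Y n) := by
  have hk' : (0 : ℝ) < k := Nat.cast_pos.2 hk
  have hηk : 0 < η * k := mul_pos hη hk'
  have hηk1 : η * k ≤ 1 * k := by gcongr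
  have hlk : (1 : ℝ) * k ≤ l * k := by gcongr; exact_mod_cast hl
  have hηγk : 11 * η * k ≤ γ * k := by gcongr
  have hkn' : (2 * (a + 1) * l * k : ℝ) ≤ n := by exact_mod_cast hkn
  have hexcess' : 2 * l * k ≤ δ * excess X (2 * a * k) := by
    calc 2 * l * k ≤ δ * (2 * a / 3 - 1) * k := by gcongr
      _ = δ * (2 * a * k / 3 - 1 * k) := by ring
      _ ≤ δ * excess X (2 * a * k) := by gcongr; linarith
  rw [abs_lt] at hA hX hY hL hL'
  refine not_manyLeftOutAtEnd_blockWord (A := 2 * a * k) (N := 2 * (a + 1) * k) (ρ := 2 * η * k)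
    hδ (by positivity) ?_ (by linarith) (by linarith) (abs_le.2 ⟨by linarith, by linarith⟩)
    (by linarith)
  exact_mod_cast (by linarith : ((∑ i ∈ Finset.range (2 * a * k), X i : ℕ) : ℝ) ≤ n)

lemma isExpSmall_manyLeftOutAtEnd {l : ℕ} (hl : 0 < l) {δ : ℝ} (hδ : 0 < δ) (c c' : Bool) :
    IsExpSmall fun n => markLaw.real {ξ | ManyLeftOutAtEnd δ
      (blockWord c (blockLengths l (ξ ∘ Sum.inl)) n)
      (blockWord c' (blockLengths l (ξ ∘ Sum.inr)) n)} := by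
  obtain ⟨a, ha_pos, ha⟩ : ∃ a : ℕ, 0 < a ∧ 2 * l ≤ δ * (2 * a / 3 - 1) := by
    obtain ⟨a, ha⟩ := exists_nat_ge (3 / 2 * (2 * l / δ + 1))
    have hpos : 0 < 3 / 2 * (2 * l / δ + 1) := by positivity
    refine ⟨a, Nat.cast_pos.1 (hpos.trans_le ha), ?_⟩
    rw [← div_le_iff₀' hδ]
    linarith
  obtain ⟨γ, hγ, hgap⟩ := exists_pos_eventually_meanLcs_add_le hl c c' a
  set η := min 1 (γ / 11)
  have hη : 0 < η := by positivity
  have hηγ : 11 * η ≤ γ := (le_div_iff₀' (by norm_num)).1 (min_le_right _ _)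
  set d := 2 * (a + 1) * l with hd
  have hd_pos : 0 < d := by positivity
  have hA_pos : 0 < 2 * a := by positivity
  have hN_pos : 0 < 2 * (a + 1) := by positivity
  have hatypical := (((((isExpSmall_abs_sum_blockLengths_sub hl .inl hA_pos hη).measureReal_union
    (isExpSmall_abs_sum_blockLengths_sub hl .inl hN_pos hη)).measureReal_union
    (isExpSmall_abs_sum_blockLengths_sub hl .inr hN_pos hη)).measureReal_union
    (isExpSmall_excess_le l hA_pos hη)).measureReal_union
    (isExpSmall_abs_blockLcs_sub_meanLcs l c c' (C' := 2 * (a + 1)) hA_pos hη)).measureReal_union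
    (isExpSmall_abs_blockLcs_sub_meanLcs l c c' (C' := 2 * (a + 1)) hN_pos hη)
  refine (hatypical.comp_div hd_pos).measureReal_mono ?_
  have htop := Nat.tendsto_div_const_atTop hd_pos.ne'
  have hlarge := (tendsto_natCast_atTop_atTop (R := ℝ)).const_mul_atTop hη
  filter_upwards [htop.eventually hgap, htop.eventually_gt_atTop 0,
    htop.eventually (hlarge.eventually_ge_atTop d)] with n hgap hk hdk ξ hmany
  contrapose hmany
  have hn : (n : ℝ) ≤ 2 * (a + 1) * l * (n / d : ℕ) + η * (n / d : ℕ) := by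
    have hlt : (n : ℝ) < d * ((n / d : ℕ) + 1) := by
      exact_mod_cast Nat.lt_mul_div_succ n hd_pos
    push_cast [hd] at hlt hdk ⊢
    linarith
  simp only [Set.mem_union, Set.mem_ofPred_eq, not_or, not_le] at hmany
  obtain ⟨⟨⟨⟨⟨hA, hX⟩, hY⟩, hexcess⟩, hL⟩, hL'⟩ := hmany
  push_cast at hexcess
  exact not_manyLeftOutAtEnd_of_typical hl hδ.le ha hη (min_le_left _ _) hηγ hk
    (Nat.mul_div_le n d) hn hgap (mod_cast hA) (mod_cast hX) (mod_cast hY) hexcess hL hL'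

end Marks

/-! ### Transfer to arbitrary probability spaces -/

section Transfer

lemma eq_map_of_forall_singleton {α β : Type*} [Countable α] [MeasurableSpace α]
    [MeasurableSingletonClass α] [MeasurableSpace β] [MeasurableSingletonClass β] {μ : Measure β}
    {ν : Measure α} [IsProbabilityMeasure μ] [IsProbabilityMeasure ν] {f : α → β}
    (hf : f.Injective) (h : ∀ a, μ {f a} = ν {a}) : μ = ν.map f := by
  have hf' : MeasurableEmbedding f :=
    ⟨hf, .of_discrete, fun {s} _ => (s.to_countable.image f).measurableSet⟩
  have hcomap : μ.comap f = ν := Measure.ext_of_singleton fun a => by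
    rw [hf'.comap_apply, Set.image_singleton, h]
  have := Measure.isProbabilityMeasure_map (μ := ν) hf'.measurable.aemeasurable
  refine (Measure.eq_of_le_of_isProbabilityMeasure ?_).symm
  rw [← hcomap, hf'.map_comap]
  exact Measure.restrict_le_self

lemma comap_pi_comp_le {Ω ι κ β : Type*} [MeasurableSpace β] (X : ι → Ω → β) (e : κ → ι) :
    MeasurableSpace.pi.comap (fun ω i => X (e i) ω) ≤
      ⨆ i ∈ Set.range e, MeasurableSpace.comap (X i) inferInstance := by
  simp only [MeasurableSpace.pi, MeasurableSpace.comap_iSup, MeasurableSpace.comap_comp, iSup_range]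
  exact le_rfl

lemma indepFun_comp_of_disjoint_range {Ω ι κ κ' β : Type*} [MeasurableSpace Ω] [MeasurableSpace β]
    {μ : Measure Ω} {X : ι → Ω → β} (hX : iIndepFun X μ) (hmeas : ∀ i, Measurable (X i))
    {e : κ → ι} {e' : κ' → ι} (h : Disjoint (Set.range e) (Set.range e')) :
    IndepFun (fun ω i => X (e i) ω) (fun ω j => X (e' j) ω) μ :=
  indep_of_indep_of_le_left (indep_of_indep_of_le_right
    (indep_iSup_of_disjoint (fun i => (hmeas i).comap_le) hX h) (comap_pi_comp_le X e'))
    (comap_pi_comp_le X e)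

lemma measurable_sInf_setOf {α : Type*} [MeasurableSpace α] {p : α → ℕ → Prop}
    (hp : ∀ i, MeasurableSet {x | p x i}) : Measurable fun x => sInf {i | p x i} := by
  classical
  have hex (x : α) : ∃ N, p x N ∨ ∀ i, ¬ p x i := by
    by_cases h : ∃ i, p x i
    · exact h.imp fun _ => .inl
    · exact ⟨0, .inr (not_exists.1 h)⟩
  have hmeas (N : ℕ) : MeasurableSet {x | p x N ∨ ∀ i, ¬ p x i} := by
    measurability
  convert measurable_find hex hmeas with x
  by_cases h : ∃ i, p x i
  · refine (Nat.sInf_def h).trans ?_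
    exact Nat.find_congr' fun {N} => (or_iff_left fun hN => h.elim hN).symm
  · rw [(Nat.find_eq_zero _).2 (.inr (not_exists.1 h))]
    exact Nat.sInf_eq_zero.2 (.inr (Set.eq_empty_iff_forall_notMem.2 (not_exists.1 h)))

lemma measurable_blockWord (c : Bool) (n : ℕ) :
    Measurable fun B : ℕ → ℕ => blockWord c B n := by
  refine measurable_pi_lambda _ fun k => ?_
  have hindex : Measurable fun B : ℕ → ℕ => blockIndex B k :=
    measurable_sInf_setOf fun i => measurableSet_lt measurable_const
      (Finset.measurable_fun_sum _ fun j _ => measurable_pi_apply j)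
  exact (Measurable.of_discrete (f := fun i : ℕ => xor c (decide (Odd i)))).comp hindex

lemma measurable_blockLengths_comp (l : ℕ) (e : ℕ → ℕ ⊕ ℕ) (i : ℕ) :
    Measurable fun ξ : ℕ ⊕ ℕ → Fin 3 => blockLengths l (ξ ∘ e) i :=
  (Measurable.of_discrete (f := fun t : Fin 3 => l - 1 + (t : ℕ))).comp (measurable_pi_apply (e i))

/-- The part of `IsBlockModel` that does not concern the first letter: the block lengths are i.i.d.,
uniform on `{l - 1, l, l + 1}`. -/
structure AreBlockLengths {Ω : Type*} [MeasurableSpace Ω] (P : Measure Ω) (l : ℕ)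
    (B : ℕ → Ω → ℕ) : Prop where
  measurable : ∀ i, Measurable (B i)
  law : ∀ i, ∀ m ∈ ({l - 1, l, l + 1} : Set ℕ), P {ω | B i ω = m} = 1 / 3
  indep : iIndepFun B P

lemma IsBlockModel.areBlockLengths {Ω : Type*} [MeasurableSpace Ω] {P : Measure Ω} {l : ℕ}
    {c : Ω → Bool} {B : ℕ → Ω → ℕ} (h : IsBlockModel P l c B) : AreBlockLengths P l B :=
  ⟨h.measurable_B, h.law_B, h.indep_B⟩

variable {Ω : Type*} [MeasurableSpace Ω] {P : Measure Ω} [IsProbabilityMeasure P] {l : ℕ}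

lemma AreBlockLengths.map_eq (hl : 0 < l) {B : ℕ → Ω → ℕ} (hB : AreBlockLengths P l B) (i : ℕ) :
    P.map (B i) =
      (PMF.uniformOfFintype (Fin 3)).toMeasure.map fun t : Fin 3 => l - 1 + (t : ℕ) := by
  have := Measure.isProbabilityMeasure_map (μ := P) (hB.measurable i).aemeasurable
  refine eq_map_of_forall_singleton (fun s t hst => Fin.ext (by simpa using hst)) fun t => ?_
  rw [Measure.map_apply (hB.measurable i) (measurableSet_singleton _)]
  refine (hB.law i _ ?_).trans ?_
  · fin_cases t <;> simp <;> omega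
  · simp

lemma AreBlockLengths.identDistrib (hl : 0 < l) {B : ℕ → Ω → ℕ} (hB : AreBlockLengths P l B)
    {e : ℕ → ℕ ⊕ ℕ} (he : e.Injective) :
    IdentDistrib (fun ω i => B i ω) (fun ξ => blockLengths l (ξ ∘ e)) P markLaw := by
  refine .pi (Y := fun i ξ => blockLengths l (ξ ∘ e) i) (fun i => ?_) hB.indep ?_
  · refine ⟨(hB.measurable i).aemeasurable, (measurable_blockLengths_comp l e i).aemeasurable, ?_⟩
    rw [hB.map_eq hl, ← Measure.infinitePi_map_eval (fun _ : ℕ ⊕ ℕ =>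
      (PMF.uniformOfFintype (Fin 3)).toMeasure) (e i),
      Measure.map_map (g := fun t : Fin 3 => l - 1 + (t : ℕ)) .of_discrete
      (measurable_pi_apply (e i))]
    rfl
  · exact (iIndepFun_infinitePi (X := fun _ (t : Fin 3) => l - 1 + (t : ℕ))
      fun _ => .of_discrete).precomp he

lemma AreBlockLengths.identDistrib_prodMk (hl : 0 < l) {BX BY : ℕ → Ω → ℕ}
    (hX : AreBlockLengths P l BX) (hY : AreBlockLengths P l BY)
    (hXY : IndepFun (fun ω i => BX i ω) (fun ω i => BY i ω) P) :
    IdentDistrib (fun ω => (fun i => BX i ω, fun i => BY i ω))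
      (fun ξ => (blockLengths l (ξ ∘ Sum.inl), blockLengths l (ξ ∘ Sum.inr))) P markLaw :=
  (hX.identDistrib hl Sum.inl_injective).prodMk (hY.identDistrib hl Sum.inr_injective) hXY <|
    indepFun_comp_of_disjoint_range (X := fun i (ξ : ℕ ⊕ ℕ → Fin 3) => l - 1 + (ξ i : ℕ))
      (iIndepFun_infinitePi (X := fun _ (t : Fin 3) => l - 1 + (t : ℕ)) fun _ => .of_discrete)
      (fun i => (Measurable.of_discrete (f := fun t : Fin 3 => l - 1 + (t : ℕ))).comp
        (measurable_pi_apply i)) (Set.isCompl_range_inl_range_inr.disjoint)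

/-- The pairs of sequences of block lengths for which some choice of the first letters makes the
first word of length `n` leave out many blocks at the end. Quantifying over the letters makes this
an event about the block lengths alone. -/
def someManyLeftOutAtEnd (δ : ℝ) (n : ℕ) : Set ((ℕ → ℕ) × (ℕ → ℕ)) :=
  {B | ∃ c c', ManyLeftOutAtEnd δ (blockWord c B.1 n) (blockWord c' B.2 n)}

lemma measurableSet_someManyLeftOutAtEnd (δ : ℝ) (n : ℕ) :
    MeasurableSet (someManyLeftOutAtEnd δ n) := by
  have h (c c' : Bool) := ((measurable_blockWord c n).prodMap (measurable_blockWord c' n))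
    (t := {p | ManyLeftOutAtEnd δ p.1 p.2}) .of_discrete
  simp only [someManyLeftOutAtEnd, Set.ofPred_exists]
  exact .iUnion fun c => .iUnion fun c' => h c c'

lemma isExpSmall_someManyLeftOutAtEnd (hl : 0 < l) {δ : ℝ} (hδ : 0 < δ) :
    IsExpSmall fun n => markLaw.real ((fun ξ => (blockLengths l (ξ ∘ Sum.inl),
      blockLengths l (ξ ∘ Sum.inr))) ⁻¹' someManyLeftOutAtEnd δ n) := by
  refine (IsExpSmall.measureReal_iUnion fun c : Bool × Bool =>
    isExpSmall_manyLeftOutAtEnd hl hδ c.1 c.2).measureReal_mono (.of_forall ?_)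
  rintro n ξ ⟨c, c', h⟩
  exact Set.mem_iUnion.2 ⟨(c, c'), h⟩

lemma AreBlockLengths.measureReal_someManyLeftOutAtEnd (hl : 0 < l) {BX BY : ℕ → Ω → ℕ}
    (hX : AreBlockLengths P l BX) (hY : AreBlockLengths P l BY)
    (hXY : IndepFun (fun ω i => BX i ω) (fun ω i => BY i ω) P) (δ : ℝ) (n : ℕ) :
    P.real ((fun ω => (fun i => BX i ω, fun i => BY i ω)) ⁻¹' someManyLeftOutAtEnd δ n) =
      markLaw.real ((fun ξ => (blockLengths l (ξ ∘ Sum.inl), blockLengths l (ξ ∘ Sum.inr))) ⁻¹'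
        someManyLeftOutAtEnd δ n) :=
  congrArg ENNReal.toReal ((hX.identDistrib_prodMk hl hY hXY).measure_mem_eq
    (measurableSet_someManyLeftOutAtEnd δ n))

end Transfer

end BlockLCS

open BlockLCS in
theorem mainTheorem3_general {l : ℕ} (hl : 0 < l) {δ : ℝ} (hδ : 0 < δ) :
    ∃ θ : ℝ, 0 < θ ∧ ∃ n₀ : ℕ,
      ∀ (Ω : Type*) [MeasurableSpace Ω] (P : Measure Ω) [IsProbabilityMeasure P]
        (cX cY : Ω → Bool) (BX BY : ℕ → Ω → ℕ),
        AreBlockLengths P l BX → AreBlockLengths P l BY →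
        IndepFun (fun ω i => BX i ω) (fun ω i => BY i ω) P →
        ∀ n : ℕ, n₀ ≤ n →
          P.real {ω | ¬ FewLeftOutAtEnd δ (blockWord (cX ω) (fun i => BX i ω) n)
              (blockWord (cY ω) (fun i => BY i ω) n)} ≤ 2 * Real.exp (-θ * (n : ℝ)) := by
  obtain ⟨θ, hθ, hle⟩ := (isExpSmall_someManyLeftOutAtEnd hl hδ).exists_eventually_le_exp
  obtain ⟨n₀, hn₀⟩ := Filter.eventually_atTop.1 hle
  refine ⟨θ, hθ, n₀, fun Ω _ P _ cX cY BX BY hX hY hXY n hn => ?_⟩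
  have hsub : {ω | ¬ FewLeftOutAtEnd δ (blockWord (cX ω) (fun i => BX i ω) n)
      (blockWord (cY ω) (fun i => BY i ω) n)} ⊆
      (fun ω => (fun i => BX i ω, fun i => BY i ω)) ⁻¹' someManyLeftOutAtEnd δ n ∪
        (fun ω => (fun i => BY i ω, fun i => BX i ω)) ⁻¹' someManyLeftOutAtEnd δ n := fun ω hω =>
    (manyLeftOutAtEnd_of_not_few hω).imp (fun h => ⟨cX ω, cY ω, h⟩) fun h => ⟨cY ω, cX ω, h⟩
  refine (measureReal_mono hsub).trans ((measureReal_union_le _ _).trans ?_)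
  rw [two_mul]
  exact add_le_add ((hX.measureReal_someManyLeftOutAtEnd hl hY hXY δ n).trans_le (hn₀ n hn))
    ((hY.measureReal_someManyLeftOutAtEnd hl hX hXY.symm δ n).trans_le (hn₀ n hn))

theorem mainTheorem3 (l : ℕ) (hl : 0 < l) (δ : ℝ) (hδ : 0 < δ) :
    ∃ θ : ℝ, 0 < θ ∧ ∃ n₀ : ℕ,
      ∀ (Ω : Type*) [MeasurableSpace Ω] (P : Measure Ω) [IsProbabilityMeasure P]
        (cX cY : Ω → Bool) (BX BY : ℕ → Ω → ℕ),
        BlockLCS.IsBlockModel P l cX BX → BlockLCS.IsBlockModel P l cY BY →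
        IndepFun (fun ω => (cX ω, fun i => BX i ω)) (fun ω => (cY ω, fun i => BY i ω)) P →
        ∀ n : ℕ, n₀ ≤ n →
          P.real {ω | ¬ BlockLCS.FewLeftOutAtEnd δ
              (BlockLCS.blockWord (cX ω) (fun i => BX i ω) n)
              (BlockLCS.blockWord (cY ω) (fun i => BY i ω) n)} ≤
            2 * Real.exp (-θ * (n : ℝ)) := by
  obtain ⟨θ, hθ, n₀, h⟩ := mainTheorem3_general hl hδ
  exact ⟨θ, hθ, n₀, fun Ω _ P _ cX cY BX BY hX hY hXY => h Ω P cX cY BX BY hX.areBlockLengths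
    hY.areBlockLengths (hXY.comp measurable_snd measurable_snd)⟩
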